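/- **Theorem (Aldous' spectral gap conjecture, for weighted graphs).** Let $V$ be a finite set with $n=|V|\ge 2$ elements, let $E$ be the set of all unordered pairs $xy=\{x,y\}$ of distinct elements of $V$, and let $c_{xy}\ge 0$, $xy\in E$, be edge weights such that the skeleton graph, i.e. the graph on $V$ whose edges are the $xy\in E$ with $c_{xy}>0$, is connected. Denote by $G$ this weighted complete graph. The random walk on $G$ is the continuous time Markov chain with state space $V$ and generator $$\mathcal L^{RW}f(x)=\sum_{y\ne x}c_{xy}\,(f(y)-f(x)),\qquad f:V\to\mathbb R,\ x\in V .$$ The interchange process on $G$ is the continuous time Markov chain whose state space is the set $\mathcal X$ of all permutations of $V$, with generator $$\mathcal L^{IP}f(\eta)=\sum_{xy\in E}c_{xy}\,(f(\eta\tau_{xy})-f(\eta)),\qquad f:\mathcal X\to\mathbb R,\ \eta\in\mathcal X,$$ where $\tau_{xy}$ is the transposition of $x$ and $y$. For a symmetric generator $\mathcal L$ on a finite state space $S$ with $|S|\ge 2$, let $\lambda_0\le\lambda_1\le\dots\le\lambda_{|S|-1}$ be the eigenvalues of $-\mathcal L$, counted with multiplicity; the spectral gap is $\lambda_1$. Let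 $\lambda_1^{RW}(G)$ and $\lambda_1^{IP}(G)$ be the spectral gaps of $\mathcal L^{RW}$ and $\mathcal L^{IP}$. Then $$\lambda_1^{IP}(G)=\lambda_1^{RW}(G).$$ -/

import Mathlib

/-- The skeleton graph of the edge weights `c`: the edges `xy` (with `x ≠ y`) such that
`c xy > 0`. -/
def skeleton {V : Type*} (c : Sym2 V → ℝ) : SimpleGraph V :=
  SimpleGraph.fromEdgeSet {e | 0 < c e}

/-- The generator of the random walk:
`(L f) x = ∑_{y ≠ x} c_{xy} (f y - f x)`. -/
def randomWalkGenerator {V : Type*} [Fintype V] [DecidableEq V] (c : Sym2 V → ℝ) :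
    (V → ℝ) →ₗ[ℝ] (V → ℝ) where
  toFun f x := ∑ y ∈ Finset.univ.erase x, c s(x, y) * (f y - f x)
  map_add' f g := by
    funext x
    simp only [Pi.add_apply, ← Finset.sum_add_distrib]
    exact Finset.sum_congr rfl fun y _ => by ring
  map_smul' r f := by
    funext x
    simp only [Pi.smul_apply, smul_eq_mul, RingHom.id_apply, Finset.mul_sum]
    exact Finset.sum_congr rfl fun y _ => by ring

/-- The transposition `τ_{xy}` attached to the unordered pair `xy`. -/
def edgeSwap {V : Type*} [DecidableEq V] : Sym2 V → Equiv.Perm V :=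
  Sym2.lift ⟨fun x y => Equiv.swap x y, fun x y => Equiv.swap_comm x y⟩

/-- The generator of the interchange process, acting on functions of the permutations of `V`:
`(L f) η = ∑_{xy ∈ E} c_{xy} (f (η τ_{xy}) - f η)`, where `E` is the set of all edges of the
complete graph on `V`. -/
def interchangeGenerator {V : Type*} [Fintype V] [DecidableEq V] (c : Sym2 V → ℝ) :
    (Equiv.Perm V → ℝ) →ₗ[ℝ] (Equiv.Perm V → ℝ) where
  toFun f η := ∑ e ∈ (⊤ : SimpleGraph V).edgeFinset, c e * (f (η * edgeSwap e) - f η)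
  map_add' f g := by
    funext x
    simp only [Pi.add_apply, ← Finset.sum_add_distrib]
    exact Finset.sum_congr rfl fun y _ => by ring
  map_smul' r f := by
    funext x
    simp only [Pi.smul_apply, smul_eq_mul, RingHom.id_apply, Finset.mul_sum]
    exact Finset.sum_congr rfl fun y _ => by ring

/-- The real eigenvalues `λ₀ ≤ λ₁ ≤ …` of `-L`, in increasing order, each repeated according to
its multiplicity. If `L` is symmetric, there are as many as the dimension, `|S|`. -/
noncomputable def sortedEigenvalues {S : Type*} [Fintype S] (L : (S → ℝ) →ₗ[ℝ] (S → ℝ)) :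
    List ℝ :=
  (LinearMap.charpoly (-L)).roots.sort (· ≤ ·)

/-- The spectral gap of a generator `L`: the second smallest eigenvalue `λ₁` of `-L`, counted
with multiplicity. The default value is used only for lists with fewer than two entries, which
do not occur for symmetric `L` on a state space with at least two points. -/
noncomputable def spectralGap {S : Type*} [Fintype S] (L : (S → ℝ) →ₗ[ℝ] (S → ℝ)) : ℝ :=
  (sortedEigenvalues L).getD 1 0

/-! The interchange gap is at most the random walk gap because η ↦ g(η⁻¹ v) lifts random walk
eigenfunctions. The converse, `interchange_poincare`, goes by induction on the number of vertices.
Let h be an eigenfunction for the interchange gap μ. If some particle has a nonzero marginal under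
h, that marginal is a random walk eigenfunction for μ, so the random walk gap is at most μ.
Otherwise h has mean zero on every coset of the stabilizer of a vertex x, and the induction
hypothesis applies on each coset, with x removed and c_yz replaced by c_yz + c_xy c_xz / ∑ c_xv.
This reduction preserves Poincaré inequalities of the walk (`reducedWeight_poincare`), and by
`octopus_inequality` it does not increase the interchange form averaged over cosets.

The octopus inequality amounts to ∑ c_i c_j φ(τ_ij) ≥ 0 for a correlation function φ, when ∑ c_i = 0
and c ≥ 0 off x. In the group algebra put X = ∑ c_i c_j τ_ij and S = ∑ c_i². Then 2SX − X² = −(1/6)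
∑ c_i c_j c_k c_l q_ijkl over distinct quadruples, with q = 2 ∑_{V₄} σ − ∑_{3-cycles} σ
(`two_mul_sum_sub_sum_eq_distinctSum`). Paired with φ, X² is a sum of squares, so it suffices that
the sum of the q is nonpositive. This follows from q_J ≥ 0 and, for x ∉ J, from q_J being at most
the sum of the q over the four-element subsets of J ∪ {x} containing x. Both hold because the
elements concerned are positive multiples of symmetric idempotents, which is a finite check. -/

/-! ### Positivity of correlation functions -/

/-- The correlation function `σ ↦ ∑ η, f η * f (η * σ)` of a function on a finite group. -/
def correlation {G : Type*} [Group G] [Fintype G] (f : G → ℝ) (σ : G) : ℝ :=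
  ∑ η, f η * f (η * σ)

/-- Substituting η ↦ η u_a shows that the correlations form the Gram matrix of the right translates
of f. -/
theorem sum_mul_correlation_eq_sum_sq {G ι : Type*} [Group G] [Fintype G] [Fintype ι]
    (f : G → ℝ) (u : ι → G) (ε : ι → ℝ) :
    ∑ a, ∑ b, ε a * ε b * correlation f ((u a)⁻¹ * u b) = ∑ η, (∑ a, ε a * f (η * u a)) ^ 2 := by
  have h : ∀ a b, correlation f ((u a)⁻¹ * u b) = ∑ η, f (η * u a) * f (η * u b) := fun a b => by
    unfold correlation
    rw [← Equiv.sum_comp (Equiv.mulRight (u a))]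
    simp [mul_assoc]
  simp_rw [h, sq, Finset.sum_mul_sum, Finset.mul_sum]
  symm
  rw [Finset.sum_comm]
  refine Finset.sum_congr rfl fun a _ => ?_
  rw [Finset.sum_comm]
  exact Finset.sum_congr rfl fun b _ => Finset.sum_congr rfl fun η _ => by ring

/-- If `m` is a positive multiple of an idempotent of the group algebra (and symmetric), then
pairing it with a correlation function gives a nonnegative number. -/
theorem sum_mul_correlation_nonneg {G H : Type*} [Group G] [Fintype G] [Group H] [Fintype H]
    (f : H → ℝ) (h : G →* H) (m : G → ℤ) (κ : ℤ) (hκ : 0 < κ)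
    (hm : ∀ σ, ∑ τ, m τ * m (τ * σ) = κ * m σ) :
    0 ≤ ∑ σ, (m σ : ℝ) * correlation f (h σ) := by
  have key : (κ : ℝ) * ∑ σ, (m σ : ℝ) * correlation f (h σ) =
      ∑ η, (∑ a, (m a : ℝ) * f (η * h a)) ^ 2 := by
    rw [← sum_mul_correlation_eq_sum_sq f h (fun a => (m a : ℝ))]
    have : ∀ a, ∑ b, (m a : ℝ) * m b * correlation f ((h a)⁻¹ * h b) =
        ∑ b, (m a : ℝ) * m (a * b) * correlation f (h b) := fun a => by
      rw [← Equiv.sum_comp (Equiv.mulLeft a)]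
      simp
    simp_rw [this]
    rw [Finset.sum_comm, Finset.mul_sum]
    refine Finset.sum_congr rfl fun σ _ => ?_
    rw [← Finset.sum_mul, ← mul_assoc]
    congr 1
    exact_mod_cast (hm σ).symm
  have hκ' : (0 : ℝ) < κ := by exact_mod_cast hκ
  refine nonneg_of_mul_nonneg_right ?_ hκ'
  rw [key]
  positivity

/-! ### Four points: the tetrahedral element -/

open Equiv in
theorem viaEmbeddingHom_swap {α β : Type*} [DecidableEq α] [DecidableEq β] (ι : α ↪ β) (a b : α) :
    Perm.viaEmbeddingHom ι (swap a b) = swap (ι a) (ι b) := by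
  ext x
  rw [Perm.viaEmbeddingHom_apply]
  by_cases hx : x ∈ Set.range ι
  · obtain ⟨y, rfl⟩ := hx
    rw [Perm.viaEmbedding_apply, ι.injective.map_swap]
  · rw [Perm.viaEmbedding_apply_of_notMem _ _ _ hx, swap_apply_of_ne_of_ne]
    · rintro rfl; exact hx ⟨a, rfl⟩
    · rintro rfl; exact hx ⟨b, rfl⟩

open Equiv in
/-- The pairing of `φ` with the element `2 ∑_{V₄} σ - ∑_{3-cycles} σ` of the group algebra of the
alternating group on `{i, j, k, l}`. -/
def tetrahedralForm {V : Type*} [DecidableEq V] (φ : Perm V → ℝ) (i j k l : V) : ℝ :=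
  2 * φ 1 + 2 * φ (swap i j * swap k l) + 2 * φ (swap i k * swap j l)
    + 2 * φ (swap i l * swap j k)
    - (φ (swap i j * swap j k) + φ (swap j k * swap i j))
    - (φ (swap i j * swap j l) + φ (swap j l * swap i j))
    - (φ (swap i k * swap k l) + φ (swap k l * swap i k))
    - (φ (swap j k * swap k l) + φ (swap k l * swap j k))

open Equiv in
theorem tetrahedralForm_comp {α V : Type*} [DecidableEq α] [DecidableEq V] (φ : Perm V → ℝ)
    (ι : α ↪ V) (i j k l : α) :
    tetrahedralForm (fun σ => φ (Perm.viaEmbeddingHom ι σ)) i j k l =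
      tetrahedralForm φ (ι i) (ι j) (ι k) (ι l) := by
  simp only [tetrahedralForm, map_mul, viaEmbeddingHom_swap, map_one]

theorem sum_mul_eq_list_sum {G : Type*} [Fintype G] [DecidableEq G] (m : G → ℤ) (L : List G)
    (hL : L.Nodup) (hm : ∀ σ, m σ ≠ 0 → σ ∈ L) (φ : G → ℝ) :
    ∑ σ, (m σ : ℝ) * φ σ = (L.map fun σ => (m σ : ℝ) * φ σ).sum := by
  rw [← List.sum_toFinset _ hL]
  symm
  refine Finset.sum_subset (Finset.subset_univ _) fun σ _ hσ => ?_
  have : m σ = 0 := by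
    by_contra h
    exact hσ (List.mem_toFinset.2 (hm σ h))
  simp [this]

open Equiv in
/-- The coefficients of `tetrahedralForm` on four points. -/
def tetrahedralCoeff (σ : Perm (Fin 4)) : ℤ :=
  -- The number of fixed points determines the cycle type, except that four-cycles and double
  -- transpositions both have none.
  match (List.finRange 4).countP (fun i => σ i = i) with
  | 4 => 2
  | 1 => -1
  | 0 => if σ * σ = 1 then 2 else 0
  | _ => 0

open Equiv in
theorem tetrahedralForm_eq_sum (φ : Perm (Fin 4) → ℝ) :
    tetrahedralForm φ 0 1 2 3 = ∑ σ, (tetrahedralCoeff σ : ℝ) * φ σ := by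
  rw [sum_mul_eq_list_sum tetrahedralCoeff
    [1, swap 0 1 * swap 2 3, swap 0 2 * swap 1 3, swap 0 3 * swap 1 2,
      swap 0 1 * swap 1 2, swap 1 2 * swap 0 1, swap 0 1 * swap 1 3, swap 1 3 * swap 0 1,
      swap 0 2 * swap 2 3, swap 2 3 * swap 0 2, swap 1 2 * swap 2 3, swap 2 3 * swap 1 2]
    (by decide) (by decide +kernel)]
  have h1 : tetrahedralCoeff 1 = 2 := by decide
  have h2 : tetrahedralCoeff (swap 0 1 * swap 2 3) = 2 := by decide
  have h3 : tetrahedralCoeff (swap 0 2 * swap 1 3) = 2 := by decide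
  have h4 : tetrahedralCoeff (swap 0 3 * swap 1 2) = 2 := by decide
  have h5 : tetrahedralCoeff (swap 0 1 * swap 1 2) = -1 := by decide
  have h6 : tetrahedralCoeff (swap 1 2 * swap 0 1) = -1 := by decide
  have h7 : tetrahedralCoeff (swap 0 1 * swap 1 3) = -1 := by decide
  have h8 : tetrahedralCoeff (swap 1 3 * swap 0 1) = -1 := by decide
  have h9 : tetrahedralCoeff (swap 0 2 * swap 2 3) = -1 := by decide
  have h10 : tetrahedralCoeff (swap 2 3 * swap 0 2) = -1 := by decide
  have h11 : tetrahedralCoeff (swap 1 2 * swap 2 3) = -1 := by decide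
  have h12 : tetrahedralCoeff (swap 2 3 * swap 1 2) = -1 := by decide
  simp only [List.map_cons, List.map_nil, List.sum_cons, List.sum_nil, h1, h2, h3, h4, h5, h6, h7,
    h8, h9, h10, h11, h12, tetrahedralForm]
  push_cast
  ring

open Equiv in
-- In the group algebra q = 3 ∑_{V₄} − ∑_{A₄}, hence q² = 36 ∑_{V₄} − 12 ∑_{A₄} = 12 q.
theorem tetrahedralForm_nonneg {V : Type*} [DecidableEq V] [Fintype V] (f : Perm V → ℝ)
    {i j k l : V} (hd : [i, j, k, l].Nodup) :
    0 ≤ tetrahedralForm (correlation f) i j k l := by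
  let ι : Fin 4 ↪ V := ⟨[i, j, k, l].get, List.nodup_iff_injective_get.1 hd⟩
  have h := sum_mul_correlation_nonneg f (Perm.viaEmbeddingHom ι) tetrahedralCoeff 12 (by norm_num)
    (by decide +kernel)
  have h' := tetrahedralForm_comp (correlation f) ι 0 1 2 3
  rw [tetrahedralForm_eq_sum] at h'
  exact h.trans_eq h'

/-! ### Five points: the pentatope element -/

/-- The coefficient, in terms of a permutation as a function, of the element
`∑_{0 ∈ J} q_J - q_{1234}` of the group algebra, where `q_J` is the element defining
`tetrahedralForm` on the four-element set `J`. -/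
def pentatopeCoeff (s : Fin 5 → Fin 5) : ℤ :=
  match (List.finRange 5).countP (fun i => s i = i) with
  | 5 => 6
  -- A three-cycle fixing 0 occurs in one q_J with 0 ∈ J and in q_1234, so it cancels; one moving 0
  -- occurs in two of the q_J.
  | 2 => if s 0 = 0 then 0 else -2
  | 1 => if s (s 0) = 0 ∧ s (s 1) = 1 ∧ s (s 2) = 2 ∧ s (s 3) = 3 then
      (if s 0 = 0 then -2 else 2) else 0
  | _ => 0

open Equiv in
/-- The permutations at which `pentatopeCoeff` does not vanish. -/
def pentatopeSupport : List (Perm (Fin 5)) :=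
  [1, swap 1 2 * swap 3 4, swap 1 3 * swap 2 4, swap 1 4 * swap 2 3,
    swap 0 1 * swap 2 3, swap 0 1 * swap 2 4, swap 0 1 * swap 3 4,
    swap 0 2 * swap 1 3, swap 0 2 * swap 1 4, swap 0 2 * swap 3 4,
    swap 0 3 * swap 1 2, swap 0 3 * swap 1 4, swap 0 3 * swap 2 4,
    swap 0 4 * swap 1 2, swap 0 4 * swap 1 3, swap 0 4 * swap 2 3,
    swap 0 1 * swap 1 2, swap 1 2 * swap 0 1, swap 0 1 * swap 1 3, swap 1 3 * swap 0 1,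
    swap 0 1 * swap 1 4, swap 1 4 * swap 0 1, swap 0 2 * swap 2 3, swap 2 3 * swap 0 2,
    swap 0 2 * swap 2 4, swap 2 4 * swap 0 2, swap 0 3 * swap 3 4, swap 3 4 * swap 0 3]

open Equiv in
theorem pentatopeSupport_map_coeff :
    (pentatopeSupport.map fun σ : Perm (Fin 5) => pentatopeCoeff σ) =
      6 :: (List.replicate 3 (-2) ++ List.replicate 12 2 ++ List.replicate 12 (-2)) := by
  decide +kernel

open Equiv in
theorem mem_pentatopeSupport (σ : Perm (Fin 5)) (h : pentatopeCoeff σ ≠ 0) :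
    σ ∈ pentatopeSupport := by
  revert σ
  decide +kernel

open Equiv in
theorem sum_mul_eq_pentatopeSupport_sum (φ : Perm (Fin 5) → ℝ) :
    ∑ σ : Perm (Fin 5), (pentatopeCoeff σ : ℝ) * φ σ =
      (pentatopeSupport.map fun σ : Perm (Fin 5) => (pentatopeCoeff σ : ℝ) * φ σ).sum :=
  sum_mul_eq_list_sum (fun σ : Perm (Fin 5) => pentatopeCoeff σ) _ (by decide +kernel)
    mem_pentatopeSupport φ

open Equiv in
theorem pentatopeForm_eq_sum (φ : Perm (Fin 5) → ℝ) :
    tetrahedralForm φ 0 1 2 3 + tetrahedralForm φ 0 1 2 4 + tetrahedralForm φ 0 1 3 4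
        + tetrahedralForm φ 0 2 3 4 - tetrahedralForm φ 1 2 3 4 =
      ∑ σ : Perm (Fin 5), (pentatopeCoeff σ : ℝ) * φ σ := by
  -- Separating the integer coefficients from the values of φ lets them be replaced by the closed
  -- evaluation `pentatopeSupport_map_coeff`.
  have h : (pentatopeSupport.map fun σ : Perm (Fin 5) => (pentatopeCoeff σ : ℝ) * φ σ) =
      List.zipWith (fun (c : ℤ) x => (c : ℝ) * x)
        (pentatopeSupport.map fun σ : Perm (Fin 5) => pentatopeCoeff σ) (pentatopeSupport.map φ) := by
    rw [List.zipWith_map, List.zipWith_self]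
  rw [sum_mul_eq_pentatopeSupport_sum, h, pentatopeSupport_map_coeff]
  simp only [pentatopeSupport, List.map_cons, List.map_nil, List.replicate, List.cons_append,
    List.nil_append, List.zipWith_cons_cons, List.zipWith_nil_left, List.sum_cons, List.sum_nil,
    tetrahedralForm]
  push_cast
  ring

open Equiv in
-- Coding a permutation by its five values, and summing over the 28 support elements only, keeps the
-- kernel computation small.
theorem pentatopeCoeff_convolution_aux : ∀ a b c d e : Fin 5, [a, b, c, d, e].Nodup →
    (pentatopeSupport.map fun τ : Perm (Fin 5) => pentatopeCoeff τ * pentatopeCoeff (τ ∘ ![a, b, c, d, e])).sum =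
      24 * pentatopeCoeff ![a, b, c, d, e] := by
  decide +kernel

open Equiv in
theorem pentatopeCoeff_convolution (σ : Perm (Fin 5)) :
    ∑ τ : Perm (Fin 5), pentatopeCoeff τ * pentatopeCoeff (τ * σ : Perm (Fin 5)) =
      24 * pentatopeCoeff σ := by
  have hσ : ![σ 0, σ 1, σ 2, σ 3, σ 4] = σ := by
    funext i
    fin_cases i <;> rfl
  have h := pentatopeCoeff_convolution_aux (σ 0) (σ 1) (σ 2) (σ 3) (σ 4)
    (by simp [List.nodup_cons, σ.injective.eq_iff])
  rw [hσ] at h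
  have h2 := sum_mul_eq_pentatopeSupport_sum fun τ : Perm (Fin 5) => (pentatopeCoeff (τ * σ : Perm (Fin 5)) : ℝ)
  rw [← h]
  have h3 : ((∑ τ : Perm (Fin 5), pentatopeCoeff τ * pentatopeCoeff (τ * σ : Perm (Fin 5)) : ℤ) : ℝ)
      = ((pentatopeSupport.map fun τ : Perm (Fin 5) =>
        pentatopeCoeff τ * pentatopeCoeff (τ * σ : Perm (Fin 5))).sum : ℤ) := by
    rw [Int.cast_list_sum, List.map_map]
    simpa [Function.comp_def] using h2
  exact_mod_cast h3

open Equiv in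
-- The difference of the two sides pairs the correlation function with an element p satisfying p² =
-- 24 p.
theorem tetrahedralForm_le_sum {V : Type*} [DecidableEq V] [Fintype V] (f : Perm V → ℝ)
    {x j k l m : V} (hd : [x, j, k, l, m].Nodup) :
    tetrahedralForm (correlation f) j k l m ≤
      tetrahedralForm (correlation f) x j k l + tetrahedralForm (correlation f) x j k m
        + tetrahedralForm (correlation f) x j l m + tetrahedralForm (correlation f) x k l m := by
  let ι : Fin 5 ↪ V := ⟨[x, j, k, l, m].get, List.nodup_iff_injective_get.1 hd⟩
  have h := sum_mul_correlation_nonneg f (Perm.viaEmbeddingHom ι)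
    (fun σ : Perm (Fin 5) => pentatopeCoeff σ) 24 (by norm_num) pentatopeCoeff_convolution
  rw [← pentatopeForm_eq_sum (fun σ => correlation f (Perm.viaEmbeddingHom ι σ))] at h
  simp only [tetrahedralForm_comp] at h
  have h0 : ι 0 = x := rfl
  have h1 : ι 1 = j := rfl
  have h2 : ι 2 = k := rfl
  have h3 : ι 3 = l := rfl
  have h4 : ι 4 = m := rfl
  rw [h0, h1, h2, h3, h4] at h
  linarith

/-! ### Symmetry of the tetrahedral form and sums over distinct quadruples -/

/-- The indicator function of `i ≠ j`. -/
def neInd {V : Type*} [DecidableEq V] (i j : V) : ℝ := if i = j then 0 else 1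

theorem neInd_comm {V : Type*} [DecidableEq V] (i j : V) : neInd i j = neInd j i := by
  simp [neInd, eq_comm]

/-- The indicator function of quadruples with distinct entries. -/
def distinctInd {V : Type*} [DecidableEq V] (i j k l : V) : ℝ :=
  neInd i j * neInd i k * neInd i l * neInd j k * neInd j l * neInd k l

theorem distinctInd_nonneg {V : Type*} [DecidableEq V] (i j k l : V) :
    0 ≤ distinctInd i j k l := by
  have h : ∀ i j : V, 0 ≤ neInd i j := fun i j => by unfold neInd; split_ifs <;> norm_num
  unfold distinctInd
  have := h i j; have := h i k; have := h i l; have := h j k; have := h j l; have := h k l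
  positivity

theorem distinctInd_eq_ite {V : Type*} [DecidableEq V] (i j k l : V) :
    distinctInd i j k l = if [i, j, k, l].Nodup then 1 else 0 := by
  unfold distinctInd neInd
  by_cases h1 : i = j <;> by_cases h2 : i = k <;> by_cases h3 : i = l <;>
  by_cases h4 : j = k <;> by_cases h5 : j = l <;> by_cases h6 : k = l <;>
  simp_all

open Equiv in
theorem swap_mul_swap_rotate {V : Type*} [DecidableEq V] {i j k : V} (hij : i ≠ j) (hik : i ≠ k) :
    swap i j * swap j k = swap j k * swap k i := by
  rw [swap_mul_eq_mul_swap, swap_inv, mul_left_cancel_iff]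
  rw [swap_apply_left, swap_apply_of_ne_of_ne hij hik, swap_comm]

open Equiv in
theorem swap_mul_swap_comm {V : Type*} [DecidableEq V] {i j k l : V} (hd : [i, j, k, l].Nodup) :
    swap i j * swap k l = swap k l * swap i j :=
  (Perm.disjoint_swap_swap hd).commute

theorem nodup_four {V : Type*} {i j k l : V} (hd : [i, j, k, l].Nodup) :
    i ≠ j ∧ i ≠ k ∧ i ≠ l ∧ j ≠ k ∧ j ≠ l ∧ k ≠ l := by
  simp at hd
  tauto

open Equiv in
-- V₄ and the set of three-cycles are both stable under relabelling the four points; exchanging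
-- neighbouring labels generates all relabellings.
theorem tetrahedralForm_swap₀₁ {V : Type*} [DecidableEq V] (φ : Perm V → ℝ) {i j k l : V}
    (hd : [i, j, k, l].Nodup) : tetrahedralForm φ j i k l = tetrahedralForm φ i j k l := by
  obtain ⟨hij, hik, hil, hjk, hjl, hkl⟩ := nodup_four hd
  unfold tetrahedralForm
  have e1 : swap j k * swap i l = swap i l * swap j k :=
    swap_mul_swap_comm (by simp; tauto)
  have e2 : swap j l * swap i k = swap i k * swap j l :=
    swap_mul_swap_comm (by simp; tauto)
  have r1 : ∀ k, i ≠ k → j ≠ k → swap i j * swap j k = swap i k * swap i j := fun k hik hjk => by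
    rw [swap_mul_swap_rotate hij hik, swap_mul_swap_rotate hjk hij.symm, swap_comm k i]
  have r2 : ∀ k, i ≠ k → j ≠ k → swap j k * swap i j = swap i j * swap i k := fun k hik hjk => by
    rw [swap_comm i j, swap_mul_swap_rotate hij.symm hjk, swap_mul_swap_rotate hik hij,
      swap_comm k j]
  rw [e1, e2, swap_comm j i, r1 k hik hjk, r2 k hik hjk, r1 l hil hjl, r2 l hil hjl]
  ring

open Equiv in
theorem tetrahedralForm_swap₁₂ {V : Type*} [DecidableEq V] (φ : Perm V → ℝ) {i j k l : V}
    (hd : [i, j, k, l].Nodup) : tetrahedralForm φ i k j l = tetrahedralForm φ i j k l := by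
  obtain ⟨hij, hik, hil, hjk, hjl, hkl⟩ := nodup_four hd
  unfold tetrahedralForm
  have r1 : swap i k * swap j k = swap j k * swap i j := by
    rw [swap_comm j k, swap_mul_swap_rotate hik hij, swap_comm j i]
  have r2 : swap j k * swap i k = swap i j * swap j k := by
    rw [swap_mul_swap_rotate hij hik, swap_comm k i]
  have r3 : swap k l * swap j k = swap j k * swap j l := by
    rw [swap_comm k l, swap_comm j k, swap_mul_swap_rotate hjk.symm hkl,
      swap_mul_swap_rotate hjl hjk]
  have r4 : swap j k * swap k l = swap j l * swap j k := by
    rw [swap_mul_swap_rotate hjk hjl, swap_mul_swap_rotate hkl hjk.symm, swap_comm l j]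
  rw [swap_comm k j, r1, r2, r3, r4]
  ring

open Equiv in
theorem tetrahedralForm_swap₂₃ {V : Type*} [DecidableEq V] (φ : Perm V → ℝ) {i j k l : V}
    (hd : [i, j, k, l].Nodup) : tetrahedralForm φ i j l k = tetrahedralForm φ i j k l := by
  obtain ⟨hij, hik, hil, hjk, hjl, hkl⟩ := nodup_four hd
  unfold tetrahedralForm
  have r1 : ∀ i, i ≠ l → i ≠ k → swap i l * swap k l = swap k l * swap i k := fun i hil hik => by
    rw [swap_comm k l, swap_mul_swap_rotate hil hik, swap_comm k i]
  have r2 : ∀ i, i ≠ l → i ≠ k → swap k l * swap i l = swap i k * swap k l := fun i hil hik => by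
    rw [swap_mul_swap_rotate hik hil, swap_comm l i]
  rw [swap_comm l k, r1 i hil hik, r2 i hil hik, r1 j hjl hjk, r2 j hjl hjk]
  ring

theorem tetrahedralForm_swap₀₂ {V : Type*} [DecidableEq V] (φ : Equiv.Perm V → ℝ) {i j k l : V}
    (hd : [i, j, k, l].Nodup) : tetrahedralForm φ k j i l = tetrahedralForm φ i j k l := by
  obtain ⟨hij, hik, hil, hjk, hjl, hkl⟩ := nodup_four hd
  rw [tetrahedralForm_swap₀₁ φ (i := j) (j := k) (by simp; tauto),
    tetrahedralForm_swap₁₂ φ (j := i) (k := k) (by simp; tauto), tetrahedralForm_swap₀₁ φ hd]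

theorem tetrahedralForm_swap₀₃ {V : Type*} [DecidableEq V] (φ : Equiv.Perm V → ℝ) {i j k l : V}
    (hd : [i, j, k, l].Nodup) : tetrahedralForm φ l j k i = tetrahedralForm φ i j k l := by
  obtain ⟨hij, hik, hil, hjk, hjl, hkl⟩ := nodup_four hd
  rw [tetrahedralForm_swap₂₃ φ (k := i) (l := k) (by simp; tauto),
    tetrahedralForm_swap₀₂ φ (i := i) (k := l) (by simp; tauto), tetrahedralForm_swap₂₃ φ hd]

/-- The weighted sum of `g` over all quadruples with distinct entries. -/
def distinctSum {V : Type*} [DecidableEq V] [Fintype V] (c : V → ℝ) (g : V → V → V → V → ℝ) : ℝ :=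
  ∑ i, ∑ j, ∑ k, ∑ l, distinctInd i j k l * (c i * c j * c k * c l) * g i j k l

section distinctSum

variable {V : Type*} [DecidableEq V] [Fintype V] (c : V → ℝ)

theorem distinctSum_add (g h : V → V → V → V → ℝ) :
    distinctSum c (fun i j k l => g i j k l + h i j k l) = distinctSum c g + distinctSum c h := by
  simp only [distinctSum, mul_add, Finset.sum_add_distrib]

theorem distinctSum_sub (g h : V → V → V → V → ℝ) :
    distinctSum c (fun i j k l => g i j k l - h i j k l) = distinctSum c g - distinctSum c h := by
  simp only [distinctSum, mul_sub, Finset.sum_sub_distrib]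

theorem distinctSum_const_mul (a : ℝ) (g : V → V → V → V → ℝ) :
    distinctSum c (fun i j k l => a * g i j k l) = a * distinctSum c g := by
  simp only [distinctSum, Finset.mul_sum]
  exact Finset.sum_congr rfl fun i _ => Finset.sum_congr rfl fun j _ =>
    Finset.sum_congr rfl fun k _ => Finset.sum_congr rfl fun l _ => by ring

theorem distinctSum_congr {g h : V → V → V → V → ℝ}
    (H : ∀ i j k l, [i, j, k, l].Nodup → g i j k l = h i j k l) :
    distinctSum c g = distinctSum c h := by
  refine Finset.sum_congr rfl fun i _ => Finset.sum_congr rfl fun j _ =>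
    Finset.sum_congr rfl fun k _ => Finset.sum_congr rfl fun l _ => ?_
  by_cases hd : [i, j, k, l].Nodup
  · rw [H i j k l hd]
  · simp [distinctInd_eq_ite, hd]

/-- Quadruples meeting x have weight zero, so the comparison is needed only where all five points
differ. -/
theorem distinctSum_mono {b : V → ℝ} (hb : ∀ i, 0 ≤ b i) {x : V} (hx : b x = 0)
    {g h : V → V → V → V → ℝ}
    (H : ∀ i j k l, [x, i, j, k, l].Nodup → g i j k l ≤ h i j k l) :
    distinctSum b g ≤ distinctSum b h := by
  refine Finset.sum_le_sum fun i _ => Finset.sum_le_sum fun j _ =>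
    Finset.sum_le_sum fun k _ => Finset.sum_le_sum fun l _ => ?_
  by_cases hd : [x, i, j, k, l].Nodup
  · have := hb i; have := hb j; have := hb k; have := hb l
    have := distinctInd_nonneg i j k l
    exact mul_le_mul_of_nonneg_left (H i j k l hd) (by positivity)
  · have : distinctInd i j k l * (b i * b j * b k * b l) = 0 := by
      by_cases hd' : [i, j, k, l].Nodup
      · have : x = i ∨ x = j ∨ x = k ∨ x = l := by
          by_contra hne
          refine hd (List.nodup_cons.2 ⟨?_, hd'⟩)
          simpa using hne
        rcases this with rfl | rfl | rfl | rfl <;> simp [hx]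
      · simp [distinctInd_eq_ite, hd']
    simp [this]

theorem distinctSum_swap₀₁ (g : V → V → V → V → ℝ) :
    distinctSum c (fun i j k l => g j i k l) = distinctSum c g := by
  unfold distinctSum
  rw [Finset.sum_comm]
  refine Finset.sum_congr rfl fun i _ => Finset.sum_congr rfl fun j _ =>
    Finset.sum_congr rfl fun k _ => Finset.sum_congr rfl fun l _ => ?_
  unfold distinctInd
  rw [neInd_comm j i]
  ring

theorem distinctSum_swap₁₂ (g : V → V → V → V → ℝ) :
    distinctSum c (fun i j k l => g i k j l) = distinctSum c g := by
  unfold distinctSum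
  refine Finset.sum_congr rfl fun i _ => ?_
  rw [Finset.sum_comm]
  refine Finset.sum_congr rfl fun j _ =>
    Finset.sum_congr rfl fun k _ => Finset.sum_congr rfl fun l _ => ?_
  unfold distinctInd
  rw [neInd_comm k j]
  ring

theorem distinctSum_swap₂₃ (g : V → V → V → V → ℝ) :
    distinctSum c (fun i j k l => g i j l k) = distinctSum c g := by
  unfold distinctSum
  refine Finset.sum_congr rfl fun i _ => Finset.sum_congr rfl fun j _ => ?_
  rw [Finset.sum_comm]
  refine Finset.sum_congr rfl fun k _ => Finset.sum_congr rfl fun l _ => ?_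
  unfold distinctInd
  rw [neInd_comm l k]
  ring

theorem distinctSum_swap₀₂ (g : V → V → V → V → ℝ) :
    distinctSum c (fun i j k l => g k j i l) = distinctSum c g :=
  (distinctSum_swap₀₁ c fun i j k l => g k i j l).trans <|
    (distinctSum_swap₁₂ c fun i j k l => g j i k l).trans <| distinctSum_swap₀₁ c g

theorem distinctSum_swap₁₃ (g : V → V → V → V → ℝ) :
    distinctSum c (fun i j k l => g i l k j) = distinctSum c g :=
  (distinctSum_swap₁₂ c fun i j k l => g i l j k).trans <|
    (distinctSum_swap₂₃ c fun i j k l => g i k j l).trans <| distinctSum_swap₁₂ c g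

theorem distinctSum_swap₀₃ (g : V → V → V → V → ℝ) :
    distinctSum c (fun i j k l => g l j k i) = distinctSum c g :=
  (distinctSum_swap₀₁ c fun i j k l => g l i k j).trans <|
    (distinctSum_swap₁₃ c fun i j k l => g j i k l).trans <| distinctSum_swap₀₁ c g

open Equiv in
-- The weight is symmetric, so relabelling merges the three double transpositions into one term and
-- the eight three-cycles into another.
theorem distinctSum_tetrahedralForm (φ : Perm V → ℝ) :
    distinctSum c (tetrahedralForm φ) =
      2 * distinctSum c (fun _ _ _ _ => φ 1)
        + 6 * distinctSum c (fun i j k l => φ (swap i j * swap k l))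
        - 8 * distinctSum c (fun i j k _ => φ (swap i j * swap j k)) := by
  unfold tetrahedralForm
  simp only [distinctSum_add, distinctSum_sub, distinctSum_const_mul]
  have d1 := distinctSum_swap₁₂ c (fun i j k l => φ (swap i j * swap k l))
  have d2 : distinctSum c (fun i j k l => φ (swap i l * swap j k)) =
      distinctSum c (fun i j k l => φ (swap i j * swap k l)) :=
    (distinctSum_swap₂₃ c (fun i j k l => φ (swap i k * swap j l))).trans d1
  let G : V → V → V → V → ℝ := fun i j k _ => φ (swap i j * swap j k)
  have c2 : distinctSum c (fun i j k l => φ (swap j k * swap i j)) = distinctSum c G := by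
    rw [← distinctSum_swap₀₂ c G]
    refine distinctSum_congr c fun i j k l _ => ?_
    simp only [G, swap_comm]
  have c3 : distinctSum c (fun i j k l => φ (swap i j * swap j l)) = distinctSum c G :=
    distinctSum_swap₂₃ c G
  have c4 : distinctSum c (fun i j k l => φ (swap j l * swap i j)) = distinctSum c G :=
    (distinctSum_swap₂₃ c (fun i j k l => φ (swap j k * swap i j))).trans c2
  have c5 : distinctSum c (fun i j k l => φ (swap i k * swap k l)) = distinctSum c G :=
    (distinctSum_swap₁₂ c (fun i j k l => φ (swap i j * swap j l))).trans c3
  have c6 : distinctSum c (fun i j k l => φ (swap k l * swap i k)) = distinctSum c G :=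
    (distinctSum_swap₁₂ c (fun i j k l => φ (swap j l * swap i j))).trans c4
  have c7 : distinctSum c (fun i j k l => φ (swap j k * swap k l)) = distinctSum c G :=
    (distinctSum_swap₀₁ c (fun i j k l => φ (swap i k * swap k l))).trans c5
  have c8 : distinctSum c (fun i j k l => φ (swap k l * swap j k)) = distinctSum c G :=
    (distinctSum_swap₀₁ c (fun i j k l => φ (swap k l * swap i k))).trans c6
  rw [d1, d2, c2, c3, c4, c5, c6, c7, c8]
  ring

end distinctSum

/-! ### The quadratic identity for weighted sums of transpositions -/

section combinatorial

variable {V : Type*} [DecidableEq V]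

theorem neInd_mul_self (i j : V) : neInd i j * neInd i j = neInd i j := by
  unfold neInd; split_ifs <;> norm_num

theorem neInd_self (i : V) : neInd i i = 0 := by simp [neInd]

theorem neInd_of_ne {i j : V} (h : i ≠ j) : neInd i j = 1 := by simp [neInd, h]

variable [Fintype V]

theorem sum_neInd_mul (i : V) (h : V → ℝ) : ∑ j, neInd i j * h j = ∑ j, h j - h i := by
  have : ∀ j, neInd i j * h j = h j - if i = j then h j else 0 := fun j => by
    unfold neInd; split_ifs <;> ring
  simp [this]

theorem sum_neInd_mul_neInd_mul {i j : V} (hij : i ≠ j) (h : V → ℝ) :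
    ∑ k, neInd i k * neInd j k * h k = ∑ k, h k - h i - h j := by
  simp_rw [mul_assoc, sum_neInd_mul]
  rw [neInd_of_ne hij.symm]
  ring

/-- The sum of `g` over all triples with distinct entries. -/
def tripleSum (g : V → V → V → ℝ) : ℝ :=
  ∑ i, ∑ j, ∑ k, neInd i j * neInd i k * neInd j k * g i j k

theorem tripleSum_add (g h : V → V → V → ℝ) :
    tripleSum (fun i j k => g i j k + h i j k) = tripleSum g + tripleSum h := by
  simp only [tripleSum, mul_add, Finset.sum_add_distrib]

theorem tripleSum_swap₀₁ (g : V → V → V → ℝ) :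
    tripleSum (fun i j k => g j i k) = tripleSum g := by
  unfold tripleSum
  rw [Finset.sum_comm]
  refine Finset.sum_congr rfl fun i _ => Finset.sum_congr rfl fun j _ =>
    Finset.sum_congr rfl fun k _ => ?_
  rw [neInd_comm j i]
  ring

theorem tripleSum_swap₁₂ (g : V → V → V → ℝ) :
    tripleSum (fun i j k => g i k j) = tripleSum g := by
  unfold tripleSum
  refine Finset.sum_congr rfl fun i _ => ?_
  rw [Finset.sum_comm]
  refine Finset.sum_congr rfl fun j _ => Finset.sum_congr rfl fun k _ => ?_
  rw [neInd_comm k j]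
  ring

theorem tripleSum_congr {g h : V → V → V → ℝ}
    (H : ∀ i j k, i ≠ j → i ≠ k → j ≠ k → g i j k = h i j k) : tripleSum g = tripleSum h := by
  refine Finset.sum_congr rfl fun i _ => Finset.sum_congr rfl fun j _ =>
    Finset.sum_congr rfl fun k _ => ?_
  by_cases h1 : i = j
  · simp [h1, neInd_self]
  by_cases h2 : i = k
  · simp [h2, neInd_self]
  by_cases h3 : j = k
  · simp [h3, neInd_self]
  rw [H i j k h1 h2 h3]

theorem tripleSum_swap₀₂ (g : V → V → V → ℝ) :
    tripleSum (fun i j k => g k j i) = tripleSum g :=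
  (tripleSum_swap₀₁ fun i j k => g k i j).trans <|
    (tripleSum_swap₁₂ fun i j k => g j i k).trans <| tripleSum_swap₀₁ g

theorem sum_sum_eq_sum_off_pair {i j : V} (hij : i ≠ j) (H : V → V → ℝ) :
    ∑ k, ∑ l, H k l =
      ∑ k, ∑ l, neInd i k * neInd j k * (neInd i l * neInd j l * H k l)
        + ∑ k, neInd i k * neInd j k * (H i k + H j k + H k i + H k j)
        + (H i i + H i j + H j i + H j j) := by
  simp_rw [← Finset.mul_sum]
  rw [← Finset.sum_add_distrib]
  simp_rw [← mul_add, sum_neInd_mul_neInd_mul hij]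
  simp only [Finset.sum_add_distrib, Finset.sum_sub_distrib]
  ring

/-- For distinct i, j, k the weights of the remaining vertices sum to −(c_i + c_j + c_k). -/
theorem distinctSum_eq_neg_tripleSum (c : V → ℝ) (hc : ∑ i, c i = 0) (g : V → V → V → ℝ) :
    distinctSum c (fun i j k _ => g i j k) =
      -tripleSum fun i j k => c i * c j * c k * (c i + c j + c k) * g i j k := by
  unfold distinctSum tripleSum
  simp_rw [← Finset.sum_neg_distrib]
  refine Finset.sum_congr rfl fun i _ => Finset.sum_congr rfl fun j _ =>
    Finset.sum_congr rfl fun k _ => ?_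
  have h : ∀ l, distinctInd i j k l * (c i * c j * c k * c l) * g i j k =
      neInd i j * neInd i k * neInd j k * c i * c j * c k * g i j k *
        (neInd i l * (neInd j l * (neInd k l * c l))) := fun l => by
    unfold distinctInd; ring
  simp_rw [h, ← Finset.mul_sum, sum_neInd_mul, hc]
  rw [neInd_comm k i, neInd_comm k j, neInd_comm j i]
  unfold neInd
  split_ifs <;> simp_all <;> ring

open Equiv in
-- The three summands of c_i + c_j + c_k contribute equally: a three-cycle can be written with the
-- squared index as the common point of its two transpositions.
theorem distinctSum_threeCycle (c : V → ℝ) (hc : ∑ i, c i = 0) (φ : Perm V → ℝ) :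
    distinctSum c (fun i j k _ => φ (swap i j * swap j k)) =
      -3 * tripleSum fun i j k => c i ^ 2 * c j * c k * φ (swap i j * swap i k) := by
  rw [distinctSum_eq_neg_tripleSum c hc]
  let h : V → V → V → ℝ := fun i j k => c i ^ 2 * c j * c k * φ (swap i j * swap i k)
  have e : (tripleSum fun i j k =>
      c i * c j * c k * (c i + c j + c k) * φ (swap i j * swap j k)) =
      tripleSum fun i j k => h i k j + h j i k + h k j i := by
    refine tripleSum_congr fun i j k hij hik hjk => ?_
    have r1 := swap_mul_swap_rotate hij hik
    have r2 := swap_mul_swap_rotate hjk hij.symm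
    simp only [h]
    rw [swap_comm i k, ← r2, ← r1, swap_comm j i, swap_comm k j, ← r1]
    ring
  rw [e]
  simp only [tripleSum_add]
  rw [tripleSum_swap₁₂ h, tripleSum_swap₀₁ h, tripleSum_swap₀₂ h]
  ring

theorem sum_neInd_mul_sq_mul_sq (c : V → ℝ) :
    ∑ i, ∑ j, neInd i j * (c i ^ 2 * c j ^ 2) = (∑ i, c i ^ 2) ^ 2 - ∑ i, c i ^ 4 := by
  simp_rw [sum_neInd_mul]
  rw [Finset.sum_sub_distrib, sq (∑ i, c i ^ 2), Finset.sum_mul_sum]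
  congr 1
  exact Finset.sum_congr rfl fun i _ => by ring

/-- Newton's identity for 24 e₄ in terms of power sums, with p₁ = 0. -/
theorem distinctSum_const (c : V → ℝ) (hc : ∑ i, c i = 0) (a : ℝ) :
    distinctSum c (fun _ _ _ _ => a) =
      (3 * (∑ i, c i ^ 2) ^ 2 - 6 * ∑ i, c i ^ 4) * a := by
  rw [distinctSum_eq_neg_tripleSum c hc (fun _ _ _ => a)]
  let h : V → V → V → ℝ := fun i j k => c i ^ 2 * c j * c k * a
  have e : (tripleSum fun i j k => c i * c j * c k * (c i + c j + c k) * a) =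
      tripleSum fun i j k => h i j k + h j i k + h k j i :=
    tripleSum_congr fun i j k _ _ _ => by simp only [h]; ring
  have h1 : tripleSum h =
      ∑ i, ∑ j, (neInd i j * (-a * c i ^ 3 * c j) - a * (neInd i j * (c i ^ 2 * c j ^ 2))) := by
    refine Finset.sum_congr rfl fun i _ => Finset.sum_congr rfl fun j _ => ?_
    have : ∀ k, neInd i j * neInd i k * neInd j k * h i j k =
        neInd i j * c i ^ 2 * c j * a * (neInd i k * (neInd j k * c k)) := fun k => by
      simp only [h]; ring
    simp_rw [this, ← Finset.mul_sum, sum_neInd_mul, hc]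
    rw [neInd_comm j i]
    linear_combination (-c i ^ 3 * c j * a) * neInd_mul_self i j
  rw [e]
  simp only [tripleSum_add]
  rw [tripleSum_swap₀₁ h, tripleSum_swap₀₂ h, h1]
  simp only [Finset.sum_sub_distrib, ← Finset.mul_sum, sum_neInd_mul_sq_mul_sq]
  simp only [sum_neInd_mul, ← Finset.mul_sum, hc, Finset.sum_sub_distrib]
  have : ∑ i, -a * c i ^ 3 * c i = -a * ∑ i, c i ^ 4 := by
    rw [Finset.mul_sum]
    exact Finset.sum_congr rfl fun i _ => by ring
  rw [this]
  simp
  ring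

open Equiv in
-- The pairs {i, j} and {k, l} share no point, one point (the product is a three-cycle) or two
-- points (the product is 1).
theorem sum_neInd_neInd_swap_mul_swap (c : V → ℝ) (φ : Perm V → ℝ) :
    ∑ i, ∑ j, ∑ k, ∑ l, neInd i j * neInd k l * (c i * c j * c k * c l) *
        φ (swap i j * swap k l) =
      distinctSum c (fun i j k l => φ (swap i j * swap k l))
        + 4 * (tripleSum fun i j k => c i ^ 2 * c j * c k * φ (swap i j * swap i k))
        + 2 * ((∑ i, c i ^ 2) ^ 2 - ∑ i, c i ^ 4) * φ 1 := by
  let h : V → V → V → ℝ := fun i j k => c i ^ 2 * c j * c k * φ (swap i j * swap i k)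
  have key : ∀ i j, ∑ k, ∑ l, neInd i j * neInd k l * (c i * c j * c k * c l) *
        φ (swap i j * swap k l) =
      ∑ k, ∑ l, distinctInd i j k l * (c i * c j * c k * c l) * φ (swap i j * swap k l)
      + ∑ k, neInd i j * neInd i k * neInd j k * (h i j k + h j i k + h i j k + h j i k)
      + 2 * φ 1 * (neInd i j * (c i ^ 2 * c j ^ 2)) := fun i j => by
    by_cases hij : i = j
    · subst hij
      simp [neInd_self, distinctInd]
    · rw [sum_sum_eq_sum_off_pair hij]
      congr 1
      · congr 1
        · refine Finset.sum_congr rfl fun k _ => Finset.sum_congr rfl fun l _ => ?_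
          unfold distinctInd; ring
        · refine Finset.sum_congr rfl fun k _ => ?_
          simp only [h]
          rw [swap_comm k i, swap_comm k j, neInd_comm k i, neInd_comm k j, swap_comm j i]
          linear_combination (neInd i j * neInd j k * c i * c j * c k) *
            (2 * c i * φ (swap i j * swap i k)) * neInd_mul_self i k
            + (neInd i j * neInd i k * c i * c j * c k) *
            (2 * c j * φ (swap i j * swap j k)) * neInd_mul_self j k
      · rw [neInd_self, neInd_self, swap_comm j i, swap_mul_self, neInd_comm j i]
        linear_combination (2 * c i ^ 2 * c j ^ 2 * φ 1) * neInd_mul_self i j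
  simp_rw [key]
  simp only [Finset.sum_add_distrib, ← Finset.mul_sum, sum_neInd_mul_sq_mul_sq]
  have e : (∑ i, ∑ j, ∑ k, neInd i j * neInd i k * neInd j k *
      (h i j k + h j i k + h i j k + h j i k)) =
      tripleSum fun i j k => h i j k + h j i k + h i j k + h j i k := rfl
  rw [e]
  simp only [tripleSum_add]
  rw [tripleSum_swap₀₁ h]
  unfold distinctSum
  ring

open Equiv in
-- Since `swap i i = 1`, removing a diagonal amounts to replacing X by X − S, so this is (X − S)²
-- paired with φ.
theorem sum_sum_neInd_swap_mul_swap (c : V → ℝ) (φ : Perm V → ℝ) :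
    ∑ i, ∑ j, ∑ k, ∑ l, neInd i j * neInd k l * (c i * c j * c k * c l) *
        φ (swap i j * swap k l) =
      ∑ i, ∑ j, ∑ k, ∑ l, c i * c j * c k * c l * φ (swap i j * swap k l)
        - 2 * (∑ i, c i ^ 2) * ∑ i, ∑ j, c i * c j * φ (swap i j)
        + (∑ i, c i ^ 2) ^ 2 * φ 1 := by
  have h1 : ∀ i j, ∑ k, ∑ l, neInd i j * neInd k l * (c i * c j * c k * c l) *
      φ (swap i j * swap k l) = neInd i j *
      (∑ k, ∑ l, c i * c j * c k * c l * φ (swap i j * swap k l)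
        - (∑ k, c k ^ 2) * (c i * c j * φ (swap i j))) := fun i j => by
    have : ∀ k l, neInd i j * neInd k l * (c i * c j * c k * c l) * φ (swap i j * swap k l) =
        neInd i j * (neInd k l * (c i * c j * c k * c l * φ (swap i j * swap k l))) :=
      fun k l => by ring
    simp_rw [this, ← Finset.mul_sum, sum_neInd_mul, Finset.sum_sub_distrib]
    congr 2
    rw [Finset.sum_mul]
    exact Finset.sum_congr rfl fun k _ => by rw [swap_self, ← Perm.one_def, mul_one]; ring
  simp_rw [h1, sum_neInd_mul]
  have h2 : ∀ i, (∑ k, ∑ l, c i * c i * c k * c l * φ (swap i i * swap k l)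
      - (∑ k, c k ^ 2) * (c i * c i * φ (swap i i))) =
      c i ^ 2 * (∑ k, ∑ l, c k * c l * φ (swap k l) - (∑ k, c k ^ 2) * φ 1) := fun i => by
    rw [swap_self, ← Perm.one_def]
    simp_rw [one_mul, mul_sub, Finset.mul_sum]
    congr 1
    · exact Finset.sum_congr rfl fun k _ => Finset.sum_congr rfl fun l _ => by ring
    · rw [Finset.sum_mul, Finset.sum_mul, Finset.mul_sum]
      exact Finset.sum_congr rfl fun k _ => by ring
  simp_rw [h2, Finset.sum_sub_distrib, ← Finset.mul_sum, ← Finset.sum_mul]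
  ring

open Equiv in
-- Compares the two evaluations of the sum over i ≠ j and k ≠ l.
theorem two_mul_sum_sub_sum_eq_distinctSum (c : V → ℝ) (hc : ∑ i, c i = 0) (φ : Perm V → ℝ) :
    2 * (∑ i, c i ^ 2) * ∑ i, ∑ j, c i * c j * φ (swap i j)
      - ∑ i, ∑ j, ∑ k, ∑ l, c i * c j * c k * c l * φ (swap i j * swap k l) =
      -(1 / 6) * distinctSum c (tetrahedralForm φ) := by
  have h1 := sum_sum_neInd_swap_mul_swap c φ
  rw [sum_neInd_neInd_swap_mul_swap] at h1
  rw [distinctSum_tetrahedralForm, distinctSum_threeCycle c hc, distinctSum_const c hc]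
  linear_combination h1

end combinatorial

/-! ### The octopus inequality -/

section octopus

variable {V : Type*} [DecidableEq V] [Fintype V]

theorem distinctSum_one_mul (c : V → ℝ) (g : V → V → V → V → ℝ) :
    distinctSum (fun _ => 1) (fun i j k l => c i * c j * c k * c l * g i j k l) =
      distinctSum c g := by
  unfold distinctSum
  exact Finset.sum_congr rfl fun i _ => Finset.sum_congr rfl fun j _ =>
    Finset.sum_congr rfl fun k _ => Finset.sum_congr rfl fun l _ => by ring

open Equiv in
theorem distinctSum_tetrahedralForm_nonpos (f : Perm V → ℝ) (c : V → ℝ) (hc : ∑ i, c i = 0)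
    (x : V) (hx : ∀ i ≠ x, 0 ≤ c i) : distinctSum c (tetrahedralForm (correlation f)) ≤ 0 := by
  set q := tetrahedralForm (correlation f) with hq
  let b : V → ℝ := fun i => if i = x then 0 else c i
  let e : V → ℝ := fun i => if i = x then 1 else 0
  have hb : ∀ i, 0 ≤ b i := fun i => by
    by_cases h : i = x
    · simp [b, h]
    · simpa [b, h] using hx i h
  have hbx : b x = 0 := by simp [b]
  have hcb : ∀ i, c i = b i + c x * e i := fun i => by
    by_cases h : i = x <;> simp [b, e, h]
  have hcx : c x = -∑ i, b i := by
    have h1 : ∑ i, c i = ∑ i, (b i + c x * e i) := Finset.sum_congr rfl fun i _ => hcb i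
    have h2 : ∑ i, e i = 1 := by simp [e]
    rw [hc, Finset.sum_add_distrib, ← Finset.mul_sum, h2] at h1
    linarith
  have hee : ∀ i j, i ≠ j → e i * e j = 0 := fun i j hij => by
    by_cases h : i = x
    · simp [e, show j ≠ x from fun h' => hij (h.trans h'.symm)]
    · simp [e, h]
  let h : V → V → V → V → ℝ := fun i j k l => e i * (b j * b k * b l * q i j k l)
  have split : distinctSum c q = distinctSum b q + 4 * (c x * distinctSum (fun _ => 1) h) := by
    rw [← distinctSum_one_mul c, ← distinctSum_one_mul b]
    have : distinctSum (fun _ => 1) (fun i j k l => c i * c j * c k * c l * q i j k l) =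
        distinctSum (fun _ => 1) (fun i j k l => b i * b j * b k * b l * q i j k l +
          c x * (h i j k l + h j i k l + h k j i l + h l j k i)) := by
      refine distinctSum_congr _ fun i j k l hd => ?_
      obtain ⟨hij, hik, hil, hjk, hjl, hkl⟩ := nodup_four hd
      simp only [h, hq]
      rw [tetrahedralForm_swap₀₁ _ hd, tetrahedralForm_swap₀₂ _ hd, tetrahedralForm_swap₀₃ _ hd,
        hcb i, hcb j, hcb k, hcb l]
      have h1 := hee i j hij
      have h2 := hee i k hik
      have h3 := hee i l hil
      have h4 := hee j k hjk
      have h5 := hee j l hjl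
      have h6 := hee k l hkl
      -- All products with two factors `e` at distinct points vanish, leaving the part of degree at
      -- most one in `c x`.
      linear_combination tetrahedralForm (correlation f) i j k l * c x ^ 2 *
        ((b k * b l + c x * e k * b l + c x * b k * e l + c x ^ 2 * e k * e l) * h1
          + (b j * b l + c x * b j * e l) * h2 + b j * b k * h3
          + (b i * b l + c x * b i * e l) * h4 + b i * b k * h5 + b i * b j * h6)
    rw [this]
    simp only [distinctSum_add, distinctSum_const_mul]
    rw [distinctSum_swap₀₁ _ h, distinctSum_swap₀₂ _ h, distinctSum_swap₀₃ _ h]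
    ring
  -- Expand −c_x = ∑ b_m. The terms with m ∈ {j, k, l} are nonnegative by `tetrahedralForm_nonneg`
  -- and are dropped.
  have hle : distinctSum b (fun i j k _ => q x i j k) ≤ -(c x * distinctSum (fun _ => 1) h) := by
    have h1 : distinctSum (fun _ => 1) h =
        ∑ j, ∑ k, ∑ l, distinctInd x j k l * (b j * b k * b l * q x j k l) := by
      unfold distinctSum
      rw [Finset.sum_eq_single x]
      · simp [h, e]
      · intro i _ hi
        simp [h, e, hi]
      · simp
    rw [h1, hcx, neg_mul, neg_neg, mul_comm]
    simp_rw [Finset.sum_mul, Finset.mul_sum]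
    refine Finset.sum_le_sum fun j _ => Finset.sum_le_sum fun k _ =>
      Finset.sum_le_sum fun l _ => ?_
    refine Finset.sum_le_sum fun m _ => ?_
    have := hb j; have := hb k; have := hb l; have := hb m
    by_cases hd : [x, j, k, l].Nodup
    · have hq0 : 0 ≤ q x j k l := tetrahedralForm_nonneg f hd
      have h2 : distinctInd x j k l = 1 := by rw [distinctInd_eq_ite, if_pos hd]
      have h3 : distinctInd j k l m ≤ 1 := by rw [distinctInd_eq_ite]; split_ifs <;> norm_num
      have := mul_le_mul_of_nonneg_right h3
        (show 0 ≤ b j * b k * b l * b m * q x j k l by positivity)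
      rw [h2]
      linarith
    · have h2 : distinctInd x j k l = 0 := by rw [distinctInd_eq_ite, if_neg hd]
      have h3 : distinctInd j k l m * (b j * b k * b l * b m) = 0 := by
        by_cases hd' : [j, k, l].Nodup
        · have : x = j ∨ x = k ∨ x = l := by
            by_contra hne
            refine hd (List.nodup_cons.2 ⟨?_, hd'⟩)
            simpa using hne
          rcases this with rfl | rfl | rfl <;> simp [hbx]
        · rw [distinctInd_eq_ite, if_neg, zero_mul]
          intro hn
          exact hd' (List.Nodup.sublist (l₂ := [j, k, l, m]) (by simp) hn)
      rw [h2, h3]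
      simp
  have hmono : distinctSum b q ≤ distinctSum b
      (fun i j k l => q x i j k + q x i j l + q x i k l + q x j k l) :=
    distinctSum_mono hb hbx fun i j k l hd => tetrahedralForm_le_sum f hd
  simp only [distinctSum_add] at hmono
  have s1 : distinctSum b (fun i j k l => q x i j l) = distinctSum b (fun i j k l => q x i j k) :=
    distinctSum_swap₂₃ b (fun i j k l => q x i j k)
  have s2 : distinctSum b (fun i j k l => q x i k l) = distinctSum b (fun i j k l => q x i j k) :=
    (distinctSum_swap₁₂ b (fun i j k l => q x i j l)).trans s1
  have s3 : distinctSum b (fun i j k l => q x j k l) = distinctSum b (fun i j k l => q x i j k) :=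
    (distinctSum_swap₀₁ b (fun i j k l => q x i k l)).trans s2
  rw [s1, s2, s3] at hmono
  linarith

open Equiv in
/-- The octopus inequality, in terms of correlation functions. -/
theorem sum_mul_correlation_swap_nonneg (f : Perm V → ℝ) (c : V → ℝ) (hc : ∑ i, c i = 0)
    (x : V) (hx : ∀ i ≠ x, 0 ≤ c i) :
    0 ≤ ∑ i, ∑ j, c i * c j * correlation f (swap i j) := by
  have h1 := two_mul_sum_sub_sum_eq_distinctSum c hc (correlation f)
  have h2 := distinctSum_tetrahedralForm_nonpos f c hc x hx
  have h3 : 0 ≤ ∑ i, ∑ j, ∑ k, ∑ l, c i * c j * c k * c l *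
      correlation f (swap i j * swap k l) := by
    have := sum_mul_correlation_eq_sum_sq f (fun p : V × V => swap p.1 p.2)
      (fun p => c p.1 * c p.2)
    simp only [Fintype.sum_prod_type, swap_inv] at this
    have h4 : ∀ i j k l, c i * c j * c k * c l = c i * c j * (c k * c l) := fun i j k l => by ring
    simp_rw [h4, this]
    positivity
  -- The identity controls only the product with 2 ∑ c_i², so c = 0 is treated separately.
  rcases (Finset.sum_nonneg fun i _ => sq_nonneg (c i) :
    0 ≤ ∑ i, c i ^ 2).eq_or_lt with h | h
  · have h0 : ∀ i, c i = 0 := fun i => by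
      have := (Finset.sum_eq_zero_iff_of_nonneg fun i _ => sq_nonneg (c i)).1 h.symm i
        (Finset.mem_univ i)
      simpa using this
    simp [h0]
  · refine nonneg_of_mul_nonneg_right (a := 2 * ∑ i, c i ^ 2) ?_ (by positivity)
    linarith

theorem sum_sub_sq_eq_correlation {G : Type*} [Group G] [Fintype G] (f : G → ℝ) (σ : G) :
    ∑ η, (f (η * σ) - f η) ^ 2 = 2 * correlation f 1 - 2 * correlation f σ := by
  have h : ∑ η, f (η * σ) ^ 2 = ∑ η, f η ^ 2 := Equiv.sum_comp (Equiv.mulRight σ) fun η => f η ^ 2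
  have h1 : correlation f 1 = ∑ η, f η ^ 2 :=
    Finset.sum_congr rfl fun η _ => by rw [mul_one, sq]
  simp_rw [sub_sq, Finset.sum_add_distrib, Finset.sum_sub_distrib, h, h1, correlation,
    Finset.mul_sum]
  have : ∀ η, 2 * f (η * σ) * f η = 2 * (f η * f (η * σ)) := fun η => by ring
  simp_rw [this, ← Finset.mul_sum]
  ring

open Equiv in
/-- The octopus inequality. -/
theorem octopus_inequality (f : Perm V → ℝ) (w : V → ℝ) (x : V) (hw : ∀ i, 0 ≤ w i) :
    ∑ y, ∑ z, w y * w z / (∑ v, w v) * ∑ η, (f (η * swap y z) - f η) ^ 2 ≤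
      2 * ∑ y, w y * ∑ η, (f (η * swap x y) - f η) ^ 2 := by
  set W := ∑ v, w v with hW
  have hW0 : 0 ≤ W := Finset.sum_nonneg fun i _ => hw i
  let E : V → V → ℝ := fun y z => ∑ η, (f (η * swap y z) - f η) ^ 2
  have hE : ∀ y z, E y z = 2 * correlation f 1 - 2 * correlation f (swap y z) := fun y z =>
    sum_sub_sq_eq_correlation f _
  have hEs : ∀ y z, E y z = E z y := fun y z => by simp only [E, swap_comm]
  have hE0 : ∀ y, E y y = 0 := fun y => by rw [hE, swap_self, ← Perm.one_def]; ring
  have hE1 : ∀ y z, 0 ≤ E y z := fun y z => Finset.sum_nonneg fun _ _ => sq_nonneg _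
  rcases hW0.eq_or_lt with h | h
  · rw [← h]
    simp only [div_zero, zero_mul, Finset.sum_const_zero]
    exact mul_nonneg zero_le_two (Finset.sum_nonneg fun y _ => mul_nonneg (hw y) (hE1 x y))
  let e : V → ℝ := fun i => if i = x then 1 else 0
  -- Removing the total mass W at x makes the weights sum to zero and leaves them nonnegative off x.
  let c : V → ℝ := fun i => w i - W * e i
  have hc : ∑ i, c i = 0 := by simp [c, e, ← hW]
  have key := sum_mul_correlation_swap_nonneg f c hc x fun i hi => by simpa [c, e, hi] using hw i
  have h2 : ∑ i, ∑ j, c i * c j * E i j ≤ 0 := by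
    have : ∑ i, ∑ j, c i * c j * E i j = 2 * correlation f 1 * ((∑ i, c i) * ∑ j, c j)
        - 2 * ∑ i, ∑ j, c i * c j * correlation f (swap i j) := by
      simp_rw [Finset.sum_mul_sum, Finset.mul_sum, ← Finset.sum_sub_distrib, hE]
      exact Finset.sum_congr rfl fun i _ => Finset.sum_congr rfl fun j _ => by ring
    rw [this, hc]
    linarith
  have h3 : ∑ i, ∑ j, c i * c j * E i j =
      ∑ i, ∑ j, w i * w j * E i j - 2 * W * ∑ y, w y * E x y := by
    have : ∀ i j, c i * c j * E i j = w i * w j * E i j - W * (e i * (w j * E i j))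
        - W * (w i * (e j * E i j)) + W ^ 2 * (e i * (e j * E i j)) := fun i j => by
      simp only [c]; ring
    simp_rw [this, Finset.sum_add_distrib, Finset.sum_sub_distrib, ← Finset.mul_sum]
    simp only [e, ite_mul, one_mul, zero_mul, Finset.sum_ite_eq', Finset.mem_univ, if_true, hE0]
    simp_rw [hEs _ x]
    ring
  have h4 : ∑ y, ∑ z, w y * w z / W * E y z = (∑ i, ∑ j, w i * w j * E i j) / W := by
    simp_rw [Finset.sum_div]
    exact Finset.sum_congr rfl fun i _ => Finset.sum_congr rfl fun j _ => by ring
  change ∑ y, ∑ z, w y * w z / W * E y z ≤ 2 * ∑ y, w y * E x y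
  rw [h4, div_le_iff₀ h]
  linarith

end octopus

/-! ### Variational description of the spectral gap -/

section spectral

variable {S : Type*} [Fintype S]

theorem exists_eigenbasis (L : (S → ℝ) →ₗ[ℝ] (S → ℝ))
    (hs : ∀ f g, ∑ x, L f x * g x = ∑ x, f x * L g x) :
    ∃ (ev : S → ℝ) (u : S → S → ℝ), L.charpoly.roots = Finset.univ.val.map ev ∧
      (∀ i, L (u i) = ev i • u i) ∧
      (∀ i j, i ≠ j → ∑ x, u i x * u j x = 0) ∧ (∀ i, ∑ x, u i x * u i x = 1) ∧
      ∀ (f : S → ℝ) (x : S), f x = ∑ i, (∑ y, f y * u i y) * u i x := by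
  classical
  let A := LinearMap.toMatrix' L
  have hA : A.IsHermitian := by
    ext i j
    have := hs (Pi.single i 1) (Pi.single j 1)
    simpa [A, LinearMap.toMatrix'_apply, Pi.single_apply] using this
  have hLA : A.toLin' = L := Matrix.toLin'_toMatrix' L
  let b := hA.eigenvectorBasis
  have hin : ∀ (f g : EuclideanSpace ℝ S), inner ℝ f g = ∑ x, g x * f x := fun f g => by
    simp [PiLp.inner_apply]
  have ho := orthonormal_iff_ite.1 b.orthonormal
  refine ⟨hA.eigenvalues, fun i => b i, ?_, fun i => ?_, fun i j hij => ?_, fun i => ?_,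
    fun f x => ?_⟩
  · rw [← hLA, Matrix.charpoly_toLin', hA.roots_charpoly_eq_eigenvalues]
    rfl
  · rw [← hLA, Matrix.toLin'_apply]
    exact hA.mulVec_eigenvectorBasis i
  · have := ho j i
    rw [hin, if_neg hij.symm] at this
    exact this
  · have := ho i i
    rw [hin, if_pos rfl] at this
    exact this
  · have := congrArg (fun v : EuclideanSpace ℝ S => v x) (b.sum_repr' (WithLp.toLp 2 f)).symm
    simpa [hin] using this

theorem exists_sort_map_eq_ofFn (ev : S → ℝ) :
    ∃ e : Fin (Fintype.card S) ≃ S, Monotone (ev ∘ e) ∧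
      (Finset.univ.val.map ev).sort (· ≤ ·) = List.ofFn (ev ∘ e) := by
  classical
  let e₀ := (Fintype.equivFin S).symm
  refine ⟨(Tuple.sort (ev ∘ e₀)).trans e₀, Tuple.monotone_sort (ev ∘ e₀), ?_⟩
  set e := (Tuple.sort (ev ∘ e₀)).trans e₀
  have hmono : Monotone (ev ∘ e) := Tuple.monotone_sort (ev ∘ e₀)
  have h : (Finset.univ.val.map ev) = (List.ofFn (ev ∘ e) : Multiset ℝ) := by
    rw [← Fin.univ_val_map, ← Multiset.map_map, ← Finset.map_univ_equiv e]
    rfl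
  rw [h, Multiset.coe_sort]
  apply List.mergeSort_of_pairwise
  simp_rw [decide_eq_true_eq, ← List.sortedLE_iff_pairwise]
  exact hmono.sortedLE_ofFn

theorem exists_spectralGap_eq [Nontrivial S] (L : (S → ℝ) →ₗ[ℝ] (S → ℝ))
    (ev : S → ℝ) (hev : (-L).charpoly.roots = Finset.univ.val.map ev) :
    ∃ i₀ i₁, i₀ ≠ i₁ ∧ spectralGap L = ev i₁ ∧ ev i₀ ≤ ev i₁ ∧ ∀ j, j ≠ i₀ → ev i₁ ≤ ev j := by
  obtain ⟨e, hmono, hsort⟩ := exists_sort_map_eq_ofFn ev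
  have hcard : 1 < Fintype.card S := Fintype.one_lt_card
  refine ⟨e ⟨0, by omega⟩, e ⟨1, hcard⟩, ?_, ?_, ?_, fun j hj => ?_⟩
  · simp
  · unfold spectralGap sortedEigenvalues
    rw [hev, hsort]
    simp [List.getD_eq_getElem?_getD, hcard]
  · exact hmono (by simp)
  · have h := hmono (show (⟨1, hcard⟩ : Fin (Fintype.card S)) ≤ e.symm j by
      by_contra h
      refine hj (e.symm_apply_eq.1 (Fin.ext ?_))
      change ¬ 1 ≤ (e.symm j).val at h
      change (e.symm j).val = 0
      omega)
    simpa using h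

/-- The variational characterization of the spectral gap of a symmetric generator. -/
theorem spectralGap_spec [Nontrivial S] (L : (S → ℝ) →ₗ[ℝ] (S → ℝ))
    (hs : ∀ f g, ∑ x, L f x * g x = ∑ x, f x * L g x)
    (hneg : ∀ f, ∑ x, f x * L f x ≤ 0) (hone : L (fun _ => 1) = 0) :
    (∃ f, f ≠ 0 ∧ ∑ x, f x = 0 ∧ L f = -spectralGap L • f) ∧
      ∀ f, ∑ x, f x = 0 → spectralGap L * ∑ x, f x ^ 2 ≤ -∑ x, f x * L f x := by
  have hs' : ∀ f g, ∑ x, (-L) f x * g x = ∑ x, f x * (-L) g x := fun f g => by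
    simpa using hs f g
  obtain ⟨ev, u, hroots, hu, horth, hnorm, hexp⟩ := exists_eigenbasis (-L) hs'
  obtain ⟨i₀, i₁, hne, hgap, hle, hmin⟩ := exists_spectralGap_eq L ev hroots
  have hLu : ∀ i, L (u i) = -ev i • u i := fun i => by
    rw [neg_smul, ← hu i]
    simp
  have hpos : ∀ i, 0 ≤ ev i := fun i => by
    have h := hneg (u i)
    rw [hLu i] at h
    have h2 : ∑ x, u i x * (-ev i • u i) x = -ev i * ∑ x, u i x * u i x := by
      rw [Finset.mul_sum]
      exact Finset.sum_congr rfl fun x _ => by simp; ring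
    rw [h2, hnorm] at h
    linarith
  have hu0 : ∀ i, u i ≠ 0 := fun i h => by
    have := hnorm i
    simp [h] at this
  have hsum : ∀ i, ev i * ∑ x, u i x = 0 := fun i => by
    have := hs (u i) (fun _ => 1)
    rw [hone, hLu] at this
    simpa [← Finset.mul_sum] using this
  rw [hgap]
  rcases (hpos i₁).eq_or_lt with h0 | h0
  -- Zero is at least a double eigenvalue: some nonzero combination of `u i₀` and `u i₁` has mean
  -- zero.
  · have h00 : ev i₀ = 0 := le_antisymm (h0 ▸ hle) (hpos i₀)
    refine ⟨?_, fun f _ => ?_⟩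
    · by_cases ha : ∑ x, u i₀ x = 0
      · exact ⟨u i₀, hu0 _, ha, by rw [hLu, h00, h0]⟩
      · refine ⟨(∑ x, u i₁ x) • u i₀ - (∑ x, u i₀ x) • u i₁, fun h => ha ?_, ?_, ?_⟩
        · have h2 : ∑ x, ((∑ x, u i₁ x) • u i₀ - (∑ x, u i₀ x) • u i₁) x * u i₁ x = 0 := by
            rw [h]; simp
          simp only [Pi.sub_apply, Pi.smul_apply, smul_eq_mul, sub_mul, mul_assoc,
            Finset.sum_sub_distrib, ← Finset.mul_sum, hnorm, horth _ _ hne] at h2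
          linarith
        · simp only [Pi.sub_apply, Pi.smul_apply, smul_eq_mul, Finset.sum_sub_distrib,
            ← Finset.mul_sum]
          ring
        · rw [map_sub, map_smul, map_smul, hLu, hLu, h00, ← h0]
          simp
    · rw [← h0, zero_mul]
      have := hneg f
      linarith
  -- Eigenvectors with positive eigenvalue are orthogonal to the constants, so the constants are
  -- spanned by `u i₀`.
  · have horth1 : ∀ j, j ≠ i₀ → ∑ x, u j x = 0 := fun j hj => by
      have h1 : 0 < ev j := h0.trans_le (hmin j hj)
      simpa [h1.ne'] using hsum j
    refine ⟨⟨u i₁, hu0 _, horth1 _ hne.symm, hLu _⟩, fun f hf => ?_⟩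
    have hone_eq : ∀ x, (1 : ℝ) = (∑ y, u i₀ y) * u i₀ x := fun x => by
      have := hexp (fun _ => 1) x
      rw [Finset.sum_eq_single i₀] at this
      · simpa using this
      · intro j _ hj
        simp [horth1 j hj]
      · simp
    have hcoef : ∑ y, f y * u i₀ y = 0 := by
      have h1 : (∑ y, u i₀ y) * ∑ y, f y * u i₀ y = 0 := by
        rw [← hf, Finset.mul_sum]
        refine Finset.sum_congr rfl fun x _ => ?_
        linear_combination (-f x) * hone_eq x
      obtain ⟨x⟩ := (inferInstance : Nonempty S)
      have h2 : ∑ y, u i₀ y ≠ 0 := fun h => by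
        have := hone_eq x
        simp [h] at this
      exact (mul_eq_zero.1 h1).resolve_left h2
    have expand : ∀ g : S → ℝ, ∑ x, f x * g x =
        ∑ i, (∑ y, f y * u i y) * ∑ x, u i x * g x := fun g => by
      conv_lhs => enter [2, x]; rw [hexp f x]
      simp_rw [Finset.sum_mul _ _ (g _)]
      rw [Finset.sum_comm]
      simp_rw [mul_assoc, Finset.mul_sum]
    have e1 : ∑ x, f x ^ 2 = ∑ i, (∑ y, f y * u i y) ^ 2 := by
      simp_rw [sq (f _)]
      rw [expand f]
      exact Finset.sum_congr rfl fun i _ => by simp_rw [sq, mul_comm (u i _)]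
    have e2 : -∑ x, f x * L f x = ∑ i, ev i * (∑ y, f y * u i y) ^ 2 := by
      rw [expand, ← Finset.sum_neg_distrib]
      refine Finset.sum_congr rfl fun i _ => ?_
      rw [← hs, hLu]
      have : ∑ x, (-ev i • u i) x * f x = -ev i * ∑ x, f x * u i x := by
        rw [Finset.mul_sum]
        exact Finset.sum_congr rfl fun x _ => by simp; ring
      rw [this]
      ring
    rw [e1, e2, Finset.mul_sum]
    refine Finset.sum_le_sum fun i _ => ?_
    by_cases hi : i = i₀
    · rw [hi, hcoef]; simp
    · exact mul_le_mul_of_nonneg_right (hmin i hi) (sq_nonneg _)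

end spectral

/-! ### Generators, Dirichlet forms and the motion of a single particle -/

section generators

theorem weight_nonneg_of_ne {V : Type*} {c : Sym2 V → ℝ}
    (hc : ∀ e ∈ (⊤ : SimpleGraph V).edgeSet, 0 ≤ c e) {x y : V} (hxy : x ≠ y) :
    0 ≤ c s(x, y) := hc _ (by simpa using hxy)

open Equiv

variable {V : Type*} [Fintype V] [DecidableEq V]

theorem sum_edgeFinset_top (F : Sym2 V → ℝ) :
    ∑ e ∈ (⊤ : SimpleGraph V).edgeFinset, F e =
      1 / 2 * ∑ x, ∑ y, if x = y then 0 else F s(x, y) := by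
  have h1 : ∑ p : V × V with p.1 ≠ p.2, F s(p.1, p.2) =
      ∑ e ∈ (⊤ : SimpleGraph V).edgeFinset, 2 * F e := by
    rw [← Finset.sum_fiberwise_of_maps_to (g := fun p : V × V => s(p.1, p.2))
      (t := (⊤ : SimpleGraph V).edgeFinset) (by simp)]
    refine Finset.sum_congr rfl fun e he => ?_
    induction e using Sym2.ind with
    | _ a b =>
    have hab : a ≠ b := by simpa using he
    have : (Finset.univ.filter fun p : V × V => p.1 ≠ p.2).filter
        (fun p => s(p.1, p.2) = s(a, b)) = {(a, b), (b, a)} := by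
      ext ⟨p, q⟩
      simp only [Finset.mem_filter, Finset.mem_univ, true_and, Sym2.eq_iff, Finset.mem_insert,
        Finset.mem_singleton, Prod.mk.injEq]
      constructor
      · tauto
      · rintro (⟨rfl, rfl⟩ | ⟨rfl, rfl⟩)
        · exact ⟨hab, Or.inl ⟨rfl, rfl⟩⟩
        · exact ⟨hab.symm, Or.inr ⟨rfl, rfl⟩⟩
    rw [this, Finset.sum_pair (by simp [hab]), Sym2.eq_swap (a := b), two_mul]
  rw [← Finset.mul_sum, Finset.sum_filter, Fintype.sum_prod_type] at h1
  have h2 : ∀ x y, (if x ≠ y then F s(x, y) else 0) = if x = y then 0 else F s(x, y) :=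
    fun x y => by split_ifs <;> simp_all
  simp only [h2] at h1
  rw [h1]
  ring

theorem randomWalkGenerator_apply (c : Sym2 V → ℝ) (f : V → ℝ) (x : V) :
    randomWalkGenerator c f x = ∑ y, c s(x, y) * (f y - f x) := by
  change ∑ y ∈ Finset.univ.erase x, c s(x, y) * (f y - f x) = _
  rw [← Finset.add_sum_erase _ _ (Finset.mem_univ x)]
  simp

theorem interchangeGenerator_apply (c : Sym2 V → ℝ) (f : Perm V → ℝ) (η : Perm V) :
    interchangeGenerator c f η =
      1 / 2 * ∑ x, ∑ y, c s(x, y) * (f (η * swap x y) - f η) := by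
  change ∑ e ∈ (⊤ : SimpleGraph V).edgeFinset, c e * (f (η * edgeSwap e) - f η) = _
  rw [sum_edgeFinset_top]
  congr 1
  refine Finset.sum_congr rfl fun x _ => Finset.sum_congr rfl fun y _ => ?_
  split_ifs with h
  · rw [h, swap_self, ← Perm.one_def]
    simp
  · rfl

/-- Twice the Dirichlet form of the random walk. -/
def randomWalkForm (c : Sym2 V → ℝ) (f : V → ℝ) : ℝ :=
  ∑ x, ∑ y, c s(x, y) * (f y - f x) ^ 2

/-- Four times the Dirichlet form of the interchange process. -/
def interchangeForm (c : Sym2 V → ℝ) (f : Perm V → ℝ) : ℝ :=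
  ∑ x, ∑ y, c s(x, y) * ∑ η, (f (η * swap x y) - f η) ^ 2

theorem sum_randomWalkGenerator_mul (c : Sym2 V → ℝ) (f g : V → ℝ) :
    ∑ x, randomWalkGenerator c f x * g x =
      -(1 / 2) * ∑ x, ∑ y, c s(x, y) * ((f y - f x) * (g y - g x)) := by
  have h1 : ∑ x, randomWalkGenerator c f x * g x =
      ∑ x, ∑ y, c s(x, y) * (f y - f x) * g x := by
    simp_rw [randomWalkGenerator_apply, Finset.sum_mul]
  have h2 : ∑ x, randomWalkGenerator c f x * g x =
      ∑ x, ∑ y, c s(x, y) * (f x - f y) * g y := by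
    rw [h1, Finset.sum_comm]
    simp_rw [Sym2.eq_swap]
  have h3 : ∑ x, ∑ y, c s(x, y) * ((f y - f x) * (g y - g x)) =
      -(∑ x, ∑ y, c s(x, y) * (f x - f y) * g y) - ∑ x, ∑ y, c s(x, y) * (f y - f x) * g x := by
    simp_rw [← Finset.sum_neg_distrib, ← Finset.sum_sub_distrib]
    exact Finset.sum_congr rfl fun x _ => Finset.sum_congr rfl fun y _ => by ring
  rw [h3, ← h1, ← h2]
  ring

theorem randomWalkGenerator_symm (c : Sym2 V → ℝ) (f g : V → ℝ) :
    ∑ x, randomWalkGenerator c f x * g x = ∑ x, f x * randomWalkGenerator c g x := by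
  simp_rw [mul_comm (f _)]
  rw [sum_randomWalkGenerator_mul, sum_randomWalkGenerator_mul]
  simp_rw [mul_comm (f _ - f _)]

theorem sum_mul_randomWalkGenerator (c : Sym2 V → ℝ) (f : V → ℝ) :
    ∑ x, f x * randomWalkGenerator c f x = -(1 / 2) * randomWalkForm c f := by
  simp_rw [mul_comm (f _), sum_randomWalkGenerator_mul, ← sq]
  rfl

theorem sum_interchangeGenerator_mul (c : Sym2 V → ℝ) (f g : Perm V → ℝ) :
    ∑ η, interchangeGenerator c f η * g η =
      1 / 2 * ∑ x, ∑ y, c s(x, y) * ∑ η, (f (η * swap x y) - f η) * g η := by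
  simp_rw [interchangeGenerator_apply, mul_assoc, ← Finset.mul_sum, Finset.sum_mul]
  rw [Finset.sum_comm]
  congr 1
  refine Finset.sum_congr rfl fun x _ => ?_
  rw [Finset.sum_comm]
  simp_rw [Finset.mul_sum, mul_assoc]

theorem interchangeGenerator_symm (c : Sym2 V → ℝ) (f g : Perm V → ℝ) :
    ∑ η, interchangeGenerator c f η * g η = ∑ η, f η * interchangeGenerator c g η := by
  simp_rw [mul_comm (f _)]
  rw [sum_interchangeGenerator_mul, sum_interchangeGenerator_mul]
  congr 1
  refine Finset.sum_congr rfl fun x _ => Finset.sum_congr rfl fun y _ => ?_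
  congr 1
  simp_rw [sub_mul, Finset.sum_sub_distrib]
  congr 1
  · rw [← Equiv.sum_comp (Equiv.mulRight (swap x y))]
    simp [mul_assoc, mul_comm]
  · simp_rw [mul_comm]

theorem sum_mul_interchangeGenerator (c : Sym2 V → ℝ) (f : Perm V → ℝ) :
    ∑ η, f η * interchangeGenerator c f η = -(1 / 4) * interchangeForm c f := by
  simp_rw [mul_comm (f _)]
  rw [sum_interchangeGenerator_mul]
  unfold interchangeForm
  have h : ∀ σ : Perm V, ∑ η, (f (η * σ) - f η) * f η =
      -(1 / 2) * ∑ η, (f (η * σ) - f η) ^ 2 := fun σ => by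
    rw [sum_sub_sq_eq_correlation]
    simp_rw [sub_mul, Finset.sum_sub_distrib]
    have h1 : ∑ η, f (η * σ) * f η = correlation f σ :=
      Finset.sum_congr rfl fun η _ => mul_comm _ _
    have h2 : ∑ η, f η * f η = correlation f 1 := by simp [correlation]
    rw [h1, h2]
    ring
  simp_rw [h, Finset.mul_sum]
  exact Finset.sum_congr rfl fun x _ => Finset.sum_congr rfl fun y _ =>
    Finset.sum_congr rfl fun η _ => by ring

theorem randomWalkForm_nonneg {c : Sym2 V → ℝ}
    (hc : ∀ e ∈ (⊤ : SimpleGraph V).edgeSet, 0 ≤ c e) (f : V → ℝ) : 0 ≤ randomWalkForm c f := by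
  refine Finset.sum_nonneg fun x _ => Finset.sum_nonneg fun y _ => ?_
  by_cases h : x = y
  · simp [h]
  · exact mul_nonneg (weight_nonneg_of_ne hc h) (sq_nonneg _)

theorem interchangeForm_nonneg {c : Sym2 V → ℝ}
    (hc : ∀ e ∈ (⊤ : SimpleGraph V).edgeSet, 0 ≤ c e) (f : Perm V → ℝ) :
    0 ≤ interchangeForm c f := by
  refine Finset.sum_nonneg fun x _ => Finset.sum_nonneg fun y _ => ?_
  by_cases h : x = y
  · rw [h, swap_self, ← Perm.one_def]
    simp
  · exact mul_nonneg (weight_nonneg_of_ne hc h) (Finset.sum_nonneg fun _ _ => sq_nonneg _)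

theorem spectralGap_randomWalkGenerator_spec [Nontrivial V] {c : Sym2 V → ℝ}
    (hc : ∀ e ∈ (⊤ : SimpleGraph V).edgeSet, 0 ≤ c e) :
    (∃ f, f ≠ 0 ∧ ∑ x, f x = 0 ∧
      randomWalkGenerator c f = -spectralGap (randomWalkGenerator c) • f) ∧
      ∀ f, ∑ x, f x = 0 →
        spectralGap (randomWalkGenerator c) * ∑ x, f x ^ 2 ≤ 1 / 2 * randomWalkForm c f := by
  have h := spectralGap_spec (randomWalkGenerator c) (randomWalkGenerator_symm c)
    (fun f => by
      rw [sum_mul_randomWalkGenerator]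
      have := randomWalkForm_nonneg hc f
      linarith)
    (by funext x; simp [randomWalkGenerator_apply])
  refine ⟨h.1, fun f hf => (h.2 f hf).trans_eq ?_⟩
  rw [sum_mul_randomWalkGenerator]
  ring

theorem spectralGap_interchangeGenerator_spec [Nontrivial V] {c : Sym2 V → ℝ}
    (hc : ∀ e ∈ (⊤ : SimpleGraph V).edgeSet, 0 ≤ c e) :
    (∃ f, f ≠ 0 ∧ ∑ η, f η = 0 ∧
      interchangeGenerator c f = -spectralGap (interchangeGenerator c) • f) ∧
      ∀ f, ∑ η, f η = 0 →
        spectralGap (interchangeGenerator c) * ∑ η, f η ^ 2 ≤ 1 / 4 * interchangeForm c f := by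
  have h := spectralGap_spec (interchangeGenerator c) (interchangeGenerator_symm c)
    (fun f => by
      rw [sum_mul_interchangeGenerator]
      have := interchangeForm_nonneg hc f
      linarith)
    (by funext x; simp [interchangeGenerator_apply])
  refine ⟨h.1, fun f hf => (h.2 f hf).trans_eq ?_⟩
  rw [sum_mul_interchangeGenerator]
  ring

/-- Only transpositions involving x move x, and each such edge appears as two ordered pairs. -/
theorem sum_sum_swap_apply (c : Sym2 V → ℝ) (g : V → ℝ) (x : V) :
    1 / 2 * ∑ a, ∑ b, c s(a, b) * (g (swap a b x) - g x) = randomWalkGenerator c g x := by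
  have h : ∀ a b, c s(a, b) * (g (swap a b x) - g x) =
      (if a = x then c s(a, b) * (g b - g x) else 0) +
        if b = x then c s(a, b) * (g a - g x) else 0 := fun a b => by
    by_cases ha : a = x
    · subst ha
      by_cases hb : b = a
      · subst hb; simp
      · simp [hb]
    · by_cases hb : b = x
      · subst hb; simp [ha]
      · simp [ha, hb, swap_apply_of_ne_of_ne (Ne.symm ha) (Ne.symm hb)]
  simp_rw [h, Finset.sum_add_distrib]
  rw [Finset.sum_comm]
  simp only [Finset.sum_ite_eq', Finset.mem_univ, if_true]
  rw [randomWalkGenerator_apply]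
  simp_rw [Sym2.eq_swap (b := x)]
  ring

/-- The particle v sits at η⁻¹ v, and right multiplication of η by a transposition applies it to
this position. -/
theorem interchangeGenerator_lift (c : Sym2 V → ℝ) (g : V → ℝ) (v : V) (η : Perm V) :
    interchangeGenerator c (fun η => g (η⁻¹ v)) η = randomWalkGenerator c g (η⁻¹ v) := by
  rw [interchangeGenerator_apply, ← sum_sum_swap_apply]
  simp

/-- The projection of a function on permutations to a function of the position of the
particle `v`. -/
def particleMarginal (f : Perm V → ℝ) (v x : V) : ℝ := ∑ η : Perm V, if η x = v then f η else 0

theorem sum_particleMarginal (f : Perm V → ℝ) (v : V) :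
    ∑ x, particleMarginal f v x = ∑ η, f η := by
  unfold particleMarginal
  rw [Finset.sum_comm]
  refine Finset.sum_congr rfl fun η _ => ?_
  rw [← Equiv.sum_comp η.symm]
  simp

/-- The adjoint of the lifting relation: a marginal of an interchange eigenfunction is zero or a
random walk eigenfunction with the same eigenvalue. -/
theorem randomWalkGenerator_particleMarginal (c : Sym2 V → ℝ) (f : Perm V → ℝ) (v : V) :
    randomWalkGenerator c (particleMarginal f v) =
      particleMarginal (interchangeGenerator c f) v := by
  funext x
  rw [← sum_sum_swap_apply]
  have h1 : ∀ a b, particleMarginal f v (swap a b x) =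
      ∑ η : Perm V, if η x = v then f (η * swap a b) else 0 := fun a b => by
    unfold particleMarginal
    rw [← Equiv.sum_comp (Equiv.mulRight (swap a b))]
    simp
  have h2 : ∀ η : Perm V, (if η x = v then interchangeGenerator c f η else 0) =
      1 / 2 * ∑ a, ∑ b, if η x = v then c s(a, b) * (f (η * swap a b) - f η) else 0 := fun η => by
    split_ifs
    · rw [interchangeGenerator_apply]
    · simp
  simp_rw [h1]
  unfold particleMarginal
  simp_rw [h2, ← Finset.mul_sum]
  congr 1
  symm
  rw [Finset.sum_comm]
  refine Finset.sum_congr rfl fun a _ => ?_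
  rw [Finset.sum_comm]
  refine Finset.sum_congr rfl fun b _ => ?_
  rw [← Finset.sum_sub_distrib, Finset.mul_sum]
  refine Finset.sum_congr rfl fun η _ => ?_
  split_ifs <;> simp

theorem sum_sq_pos_of_ne_zero {S : Type*} [Fintype S] {f : S → ℝ} (hf : f ≠ 0) :
    0 < ∑ x, f x ^ 2 := by
  obtain ⟨x, hx⟩ := Function.ne_iff.1 hf
  exact Finset.sum_pos' (fun _ _ => sq_nonneg _) ⟨x, Finset.mem_univ x, by
    have : f x ≠ 0 := hx
    positivity⟩

end generators

/-! ### Removing a vertex, and the induction -/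

section reduction

open Equiv

/-- The weights of the network obtained by removing the vertex `x`. -/
noncomputable def reducedWeight {V : Type*} [Fintype V] [DecidableEq V] (c : Sym2 V → ℝ) (x : V) :
    Sym2 {v // v ≠ x} → ℝ :=
  -- The star–mesh transform of electrical networks. If the weights at x sum to zero, the quotient
  -- is 0 and the remaining weights are unchanged.
  Sym2.lift ⟨fun y z => c s(y, z) + c s(x, y) * c s(x, z) / ∑ v : {v // v ≠ x}, c s(x, v),
    fun y z => by
      beta_reduce
      rw [Sym2.eq_swap, mul_comm (c s(x, (y : V)))]⟩

variable {V : Type*} [Fintype V] [DecidableEq V]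

theorem reducedWeight_mk (c : Sym2 V → ℝ) (x : V) (y z : {v // v ≠ x}) :
    reducedWeight c x s(y, z) =
      c s((y : V), (z : V)) + c s(x, y) * c s(x, z) / ∑ v : {v // v ≠ x}, c s(x, v) := rfl

theorem reducedWeight_nonneg {c : Sym2 V → ℝ} (hc : ∀ e ∈ (⊤ : SimpleGraph V).edgeSet, 0 ≤ c e)
    (x : V) : ∀ e ∈ (⊤ : SimpleGraph {v // v ≠ x}).edgeSet, 0 ≤ reducedWeight c x e := by
  intro e he
  induction e using Sym2.ind with
  | _ y z =>
  have hyz : y ≠ z := by simpa using he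
  have h1 := weight_nonneg_of_ne hc (Subtype.coe_injective.ne hyz)
  have h2 := fun v : {v // v ≠ x} => weight_nonneg_of_ne hc v.2.symm
  rw [reducedWeight_mk]
  exact add_nonneg h1 (div_nonneg (mul_nonneg (h2 y) (h2 z)) (Finset.sum_nonneg fun v _ => h2 v))

theorem sum_sum_mul_mul_sub_sq {S : Type*} [Fintype S] (w g : S → ℝ) :
    ∑ y, ∑ z, w y * w z * (g z - g y) ^ 2 =
      2 * (∑ y, w y) * (∑ y, w y * g y ^ 2) - 2 * (∑ y, w y * g y) ^ 2 := by
  have h : ∀ y z, w y * w z * (g z - g y) ^ 2 =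
      w y * (w z * g z ^ 2) + (w y * g y ^ 2) * w z - 2 * ((w y * g y) * (w z * g z)) :=
    fun y z => by ring
  simp_rw [h, Finset.sum_sub_distrib, Finset.sum_add_distrib, ← Finset.mul_sum,
    ← Finset.sum_mul]
  ring

/-- Splitting the terms of a symmetric double sum which vanishes on the diagonal. -/
theorem sum_sum_eq_add_sum_subtype_ne (F : V → V → ℝ) (hF : ∀ a b, F a b = F b a) (x : V)
    (hx : F x x = 0) :
    ∑ a, ∑ b, F a b =
      2 * ∑ y : {v // v ≠ x}, F x y + ∑ y : {v // v ≠ x}, ∑ z : {v // v ≠ x}, F y z := by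
  rw [Fintype.sum_eq_add_sum_subtype_ne _ x]
  simp_rw [fun a => Fintype.sum_eq_add_sum_subtype_ne (F a) x]
  rw [hx, Finset.sum_add_distrib]
  simp_rw [hF _ x]
  ring

/-- The value at x is the weighted mean of g, and the variance formula `sum_sum_mul_mul_sub_sq`
converts the energy of the star at x into that of the added edges. -/
theorem randomWalkForm_harmonicExtension {c : Sym2 V → ℝ}
    (hc : ∀ e ∈ (⊤ : SimpleGraph V).edgeSet, 0 ≤ c e) (x : V) (g : {v // v ≠ x} → ℝ) :
    randomWalkForm c (fun v => if h : v = x then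
        (∑ y : {v // v ≠ x}, c s(x, y) * g y) / ∑ y : {v // v ≠ x}, c s(x, y)
      else g ⟨v, h⟩) = randomWalkForm (reducedWeight c x) g := by
  set W := ∑ y : {v // v ≠ x}, c s(x, y) with hW
  set b := ∑ y : {v // v ≠ x}, c s(x, y) * g y with hb
  have h0 := fun v : {v // v ≠ x} => weight_nonneg_of_ne hc v.2.symm
  unfold randomWalkForm
  rw [sum_sum_eq_add_sum_subtype_ne _ (fun a b => by rw [Sym2.eq_swap]; ring) x (by simp)]
  have h1 : ∀ y : {v // v ≠ x}, (y : V) ≠ x := fun y => y.2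
  simp only [dite_true, dif_neg (h1 _), Subtype.coe_eta, reducedWeight_mk, ← hW, add_mul,
    Finset.sum_add_distrib]
  rw [add_comm, add_left_cancel_iff]
  have h2 : ∑ y : {v // v ≠ x}, ∑ z : {v // v ≠ x}, c s(x, y) * c s(x, z) / W * (g z - g y) ^ 2 =
      (∑ y : {v // v ≠ x}, ∑ z : {v // v ≠ x}, c s(x, y) * c s(x, z) * (g z - g y) ^ 2) / W := by
    simp_rw [Finset.sum_div]
    exact Finset.sum_congr rfl fun y _ => Finset.sum_congr rfl fun z _ => by ring
  rw [h2, sum_sum_mul_mul_sub_sq (fun y : {v // v ≠ x} => c s(x, y)) g, ← hW, ← hb]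
  have h3 : ∑ y : {v // v ≠ x}, c s(x, y) * (g y - b / W) ^ 2 =
      ∑ y : {v // v ≠ x}, c s(x, y) * g y ^ 2 - 2 * (b / W) * b + (b / W) ^ 2 * W := by
    rw [hb, hW]
    simp_rw [Finset.mul_sum, ← Finset.sum_sub_distrib, ← Finset.sum_add_distrib]
    exact Finset.sum_congr rfl fun y _ => by ring
  by_cases hW0 : W = 0
  · have h4 : ∀ y : {v // v ≠ x}, c s(x, y) = 0 := fun y =>
      (Finset.sum_eq_zero_iff_of_nonneg fun y _ => h0 y).1 (hW ▸ hW0) y (Finset.mem_univ y)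
    simp [h4, hW0]
  · rw [h3]
    field_simp
    ring

/-- A Poincaré inequality for the random walk is inherited by the reduced network. -/
theorem reducedWeight_poincare {c : Sym2 V → ℝ}
    (hc : ∀ e ∈ (⊤ : SimpleGraph V).edgeSet, 0 ≤ c e) (x : V) {lam : ℝ} (hlam : 0 ≤ lam)
    (H : ∀ g : V → ℝ, ∑ v, g v = 0 → lam * ∑ v, g v ^ 2 ≤ 1 / 2 * randomWalkForm c g)
    (g : {v // v ≠ x} → ℝ) (hg : ∑ v, g v = 0) :
    lam * ∑ v, g v ^ 2 ≤ 1 / 2 * randomWalkForm (reducedWeight c x) g := by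
  rw [← randomWalkForm_harmonicExtension hc]
  set a := (∑ y : {v // v ≠ x}, c s(x, y) * g y) / ∑ y : {v // v ≠ x}, c s(x, y)
  set G : V → ℝ := fun v => if h : v = x then a else g ⟨v, h⟩ with hG
  have hGx : G x = a := by simp [G]
  have hGy : ∀ y : {v // v ≠ x}, G y = g y := fun y => by simp [G, y.2]
  set n : ℝ := (Fintype.card V : ℝ) with hn
  have hn1 : 1 ≤ n := by
    have : 0 < Fintype.card V := Fintype.card_pos_iff.2 ⟨x⟩
    rw [hn]
    exact_mod_cast this
  have hsum : ∑ v, G v = a := by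
    rw [Fintype.sum_eq_add_sum_subtype_ne _ x, hGx]
    simp_rw [hGy, hg]
    ring
  have hsq : ∑ v, G v ^ 2 = a ^ 2 + ∑ v, g v ^ 2 := by
    rw [Fintype.sum_eq_add_sum_subtype_ne _ x, hGx]
    simp_rw [hGy]
  -- Centring leaves the form unchanged and lowers the square norm by a²/n, which the extra a² from
  -- the vertex x compensates.
  have key := H (fun v => G v - a / n) (by
    rw [Finset.sum_sub_distrib, hsum, Finset.sum_const, Finset.card_univ, nsmul_eq_mul, ← hn]
    field_simp
    ring)
  have hform : randomWalkForm c (fun v => G v - a / n) = randomWalkForm c G := by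
    simp [randomWalkForm]
  have hsq' : ∑ v, (G v - a / n) ^ 2 = ∑ v, g v ^ 2 + (a ^ 2 - a ^ 2 / n) := by
    simp_rw [sub_sq, Finset.sum_add_distrib, Finset.sum_sub_distrib, ← Finset.sum_mul,
      ← Finset.mul_sum, hsum, hsq, Finset.sum_const, Finset.card_univ, nsmul_eq_mul, ← hn]
    field_simp
    ring
  rw [hform, hsq'] at key
  have : 0 ≤ a ^ 2 - a ^ 2 / n := sub_nonneg.2 (div_le_self (sq_nonneg a) hn1)
  have := mul_nonneg hlam this
  linarith

/-- The coset of η₀ by the stabilizer of x consists of the η with η x = η₀ x. -/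
theorem sum_ofSubtype_eq_particleMarginal (f : Perm V → ℝ) (x : V) (η₀ : Perm V) :
    ∑ σ : Perm {v // v ≠ x}, f (η₀ * Perm.ofSubtype σ) = particleMarginal f (η₀ x) x := by
  unfold particleMarginal
  rw [← Equiv.sum_comp (Equiv.mulLeft η₀)]
  simp only [coe_mulLeft, Perm.mul_apply, EmbeddingLike.apply_eq_iff_eq]
  refine Finset.sum_of_injOn Perm.ofSubtype Perm.ofSubtype_injective.injOn (by simp) ?_ ?_
  · intro η _ hη
    rw [if_neg]
    intro hx
    refine hη ⟨η.subtypePerm (p := fun v => v ≠ x) fun v => ?_, by simp,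
      Perm.ofSubtype_subtypePerm _ fun v hv hvx => hv ?_⟩
    · rw [not_iff_not]
      conv_lhs => rw [← hx]
      exact η.injective.eq_iff
    · rw [hvx, hx]
  · intro σ _
    rw [if_pos]
    exact Perm.ofSubtype_apply_of_not_mem _ (by simp)

theorem sum_sum_ofSubtype (F : Perm V → ℝ) (x : V) :
    ∑ η₀ : Perm V, ∑ σ : Perm {v // v ≠ x}, F (η₀ * Perm.ofSubtype σ) =
      Fintype.card (Perm {v // v ≠ x}) * ∑ η, F η := by
  rw [Finset.sum_comm]
  have : ∀ σ : Perm {v // v ≠ x}, ∑ η₀ : Perm V, F (η₀ * Perm.ofSubtype σ) = ∑ η, F η :=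
    fun σ => Equiv.sum_comp (Equiv.mulRight (Perm.ofSubtype σ)) F
  simp_rw [this]
  simp

/-- Summing over all cosets replaces each local form by sums over the full group; the octopus
inequality then bounds the added edges by the star at x. -/
theorem interchangeForm_reducedWeight_le {c : Sym2 V → ℝ}
    (hc : ∀ e ∈ (⊤ : SimpleGraph V).edgeSet, 0 ≤ c e) (x : V) (f : Perm V → ℝ) :
    ∑ η₀ : Perm V, interchangeForm (reducedWeight c x) (fun σ => f (η₀ * Perm.ofSubtype σ)) ≤
      Fintype.card (Perm {v // v ≠ x}) * interchangeForm c f := by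
  let E : V → V → ℝ := fun y z => ∑ η, (f (η * swap y z) - f η) ^ 2
  have hE : ∀ y z, E y z = E z y := fun y z => by simp only [E, swap_comm]
  have hE0 : ∀ y, E y y = 0 := fun y => by
    simp only [E]; rw [swap_self, ← Perm.one_def]; simp
  have h1 : ∑ η₀ : Perm V, interchangeForm (reducedWeight c x)
      (fun σ => f (η₀ * Perm.ofSubtype σ)) = Fintype.card (Perm {v // v ≠ x}) *
      ∑ y : {v // v ≠ x}, ∑ z : {v // v ≠ x}, reducedWeight c x s(y, z) * E y z := by
    unfold interchangeForm
    rw [Finset.sum_comm, Finset.mul_sum]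
    refine Finset.sum_congr rfl fun y _ => ?_
    rw [Finset.sum_comm, Finset.mul_sum]
    refine Finset.sum_congr rfl fun z _ => ?_
    rw [← Finset.mul_sum]
    simp only [map_mul, Perm.ofSubtype_swap_eq, ← mul_assoc]
    rw [sum_sum_ofSubtype (fun η => (f (η * swap (y : V) z) - f η) ^ 2)]
    simp only [E]
    ring
  rw [h1]
  refine mul_le_mul_of_nonneg_left ?_ (Nat.cast_nonneg _)
  change _ ≤ ∑ a, ∑ b, c s(a, b) * E a b
  rw [sum_sum_eq_add_sum_subtype_ne _ (fun a b => by rw [Sym2.eq_swap, hE]) x (by simp [hE0])]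
  simp only [reducedWeight_mk, add_mul, Finset.sum_add_distrib]
  rw [add_comm, add_le_add_iff_right]
  -- The weight at x is set to 0 because diagonal values of `c` are arbitrary and do not enter the
  -- reduced weights.
  have oct := octopus_inequality f (fun v => if v = x then 0 else c s(x, v)) x fun v => by
    split_ifs with h
    · exact le_rfl
    · exact weight_nonneg_of_ne hc (Ne.symm h)
  have hne : ∀ y : {v // v ≠ x}, (y : V) ≠ x := fun y => y.2
  simp_rw [fun F : V → ℝ => Fintype.sum_eq_add_sum_subtype_ne F x] at oct
  simpa only [if_true, if_neg (hne _), zero_mul, mul_zero, zero_div, zero_add,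
    Finset.sum_const_zero] using oct

/-- A Poincaré inequality for the random walk implies the same inequality for the interchange
process. -/
theorem interchange_poincare.{u} (n : ℕ) : ∀ (V : Type u) [Fintype V] [DecidableEq V],
    Fintype.card V = n → ∀ (c : Sym2 V → ℝ),
    (∀ e ∈ (⊤ : SimpleGraph V).edgeSet, 0 ≤ c e) → ∀ lam : ℝ, 0 ≤ lam →
    (∀ g : V → ℝ, ∑ v, g v = 0 → lam * ∑ v, g v ^ 2 ≤ 1 / 2 * randomWalkForm c g) →
    ∀ f : Perm V → ℝ, ∑ η, f η = 0 → lam * ∑ η, f η ^ 2 ≤ 1 / 4 * interchangeForm c f := by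
  induction n with
  | zero =>
    intro V _ _ hcard c hc lam hlam H f hf
    have := Fintype.card_eq_zero_iff.1 hcard
    have h0 : f 1 = 0 := by simpa using hf
    have := interchangeForm_nonneg hc f
    have h1 : ∑ η, f η ^ 2 = 0 := by simp [Unique.default_eq (1 : Perm V), h0]
    rw [h1]
    linarith
  | succ n ih =>
    intro V _ _ hcard c hc lam hlam H f hf
    rcases subsingleton_or_nontrivial V with hV | hV
    · have h0 : ∀ η : Perm V, f η = 0 := fun η => by
        rw [← hf]
        exact (Fintype.sum_subsingleton _ η).symm
      have := interchangeForm_nonneg hc f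
      simp only [h0, ne_eq, OfNat.ofNat_ne_zero, not_false_eq_true, zero_pow,
        Finset.sum_const_zero, mul_zero]
      linarith
    obtain ⟨⟨h, hh0, hhsum, hheig⟩, hgap⟩ := spectralGap_interchangeGenerator_spec hc
    set μ := spectralGap (interchangeGenerator c) with hμ
    have hpos := sum_sq_pos_of_ne_zero hh0
    suffices hle : lam ≤ μ from
      (mul_le_mul_of_nonneg_right hle (Finset.sum_nonneg fun _ _ => sq_nonneg _)).trans
        (hgap f hf)
    -- If all marginals vanish, h has mean zero on each coset, as the induction hypothesis requires;
    -- otherwise a nonzero marginal is a test function in `H`.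
    by_cases hmarg : ∀ v, particleMarginal h v = 0
    · obtain ⟨x⟩ := (inferInstance : Nonempty V)
      have hcard' : Fintype.card {v // v ≠ x} = n := by
        simp [hcard]
      have hred := ih {v // v ≠ x} hcard' (reducedWeight c x) (reducedWeight_nonneg hc x) lam hlam
        (reducedWeight_poincare hc x hlam H)
      have h1 : ∑ η₀ : Perm V, lam * ∑ σ : Perm {v // v ≠ x}, h (η₀ * Perm.ofSubtype σ) ^ 2 ≤
          ∑ η₀ : Perm V, 1 / 4 * interchangeForm (reducedWeight c x)
            (fun σ => h (η₀ * Perm.ofSubtype σ)) :=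
        Finset.sum_le_sum fun η₀ _ => hred _ (by
          rw [sum_ofSubtype_eq_particleMarginal, hmarg]; rfl)
      rw [← Finset.mul_sum, ← Finset.mul_sum, sum_sum_ofSubtype (fun η => h η ^ 2)] at h1
      have h2 := interchangeForm_reducedWeight_le hc x h
      have h3 : 1 / 4 * interchangeForm c h = μ * ∑ η, h η ^ 2 := by
        have := sum_mul_interchangeGenerator c h
        rw [hheig] at this
        have e : ∑ η, h η * (-μ • h) η = -μ * ∑ η, h η ^ 2 := by
          rw [Finset.mul_sum]
          exact Finset.sum_congr rfl fun η _ => by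
            rw [Pi.smul_apply, smul_eq_mul]; ring
        rw [e] at this
        linarith
      have hN : (0 : ℝ) < Fintype.card (Perm {v // v ≠ x}) := by
        exact_mod_cast Fintype.card_pos
      have h4 : (Fintype.card (Perm {v // v ≠ x}) * ∑ η, h η ^ 2) * lam ≤
          (Fintype.card (Perm {v // v ≠ x}) * ∑ η, h η ^ 2) * μ := by
        have : (Fintype.card (Perm {v // v ≠ x}) * ∑ η, h η ^ 2) * μ =
          1 / 4 * (Fintype.card (Perm {v // v ≠ x}) * interchangeForm c h) := by
          linear_combination (-(Fintype.card (Perm {v // v ≠ x}) : ℝ)) * h3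
        rw [this]
        linarith
      exact le_of_mul_le_mul_left h4 (mul_pos hN hpos)
    · push Not at hmarg
      obtain ⟨v, hv⟩ := hmarg
      have hpos' := sum_sq_pos_of_ne_zero hv
      have h1 := H (particleMarginal h v) (by rw [sum_particleMarginal, hhsum])
      have h2 := sum_mul_randomWalkGenerator c (particleMarginal h v)
      have h3 : particleMarginal (-μ • h) v = -μ • particleMarginal h v := by
        funext x
        simp [particleMarginal, Finset.mul_sum]
      rw [randomWalkGenerator_particleMarginal, hheig, h3] at h2
      have e : ∑ x, particleMarginal h v x * (-μ • particleMarginal h v) x =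
          -μ * ∑ x, particleMarginal h v x ^ 2 := by
        rw [Finset.mul_sum]
        exact Finset.sum_congr rfl fun η _ => by
          rw [Pi.smul_apply, smul_eq_mul]; ring
      rw [e] at h2
      refine le_of_mul_le_mul_right ?_ hpos'
      linarith

end reduction

/-! ### Equality of the gaps -/

theorem theorem1p1 {V : Type*} [Fintype V] [DecidableEq V] [Nontrivial V]
    (c : Sym2 V → ℝ) (hc : ∀ e ∈ (⊤ : SimpleGraph V).edgeSet, 0 ≤ c e)
    (hconn : (skeleton c).Connected) :
    spectralGap (interchangeGenerator c) = spectralGap (randomWalkGenerator c) := by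
  obtain ⟨⟨g, hg0, hgsum, hgeig⟩, hgapRW⟩ := spectralGap_randomWalkGenerator_spec hc
  obtain ⟨⟨f, hf0, hfsum, hfeig⟩, hgapIP⟩ := spectralGap_interchangeGenerator_spec hc
  set lam := spectralGap (randomWalkGenerator c)
  set μ := spectralGap (interchangeGenerator c)
  have hpos := sum_sq_pos_of_ne_zero hg0
  have hlam : 0 ≤ lam := by
    have h1 := sum_mul_randomWalkGenerator c g
    have h2 := randomWalkForm_nonneg hc g
    have e : ∑ x, g x * (-lam • g) x = -lam * ∑ x, g x ^ 2 := by
      rw [Finset.mul_sum]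
      exact Finset.sum_congr rfl fun η _ => by rw [Pi.smul_apply, smul_eq_mul]; ring
    rw [hgeig, e] at h1
    refine nonneg_of_mul_nonneg_left ?_ hpos
    linarith
  apply le_antisymm
  · obtain ⟨v⟩ := (inferInstance : Nonempty V)
    let F : Equiv.Perm V → ℝ := fun η => g (η⁻¹ v)
    have hF0 : F ≠ 0 := by
      obtain ⟨x, hx⟩ := Function.ne_iff.1 hg0
      refine fun h => hx ?_
      have := congrFun h (Equiv.swap x v)
      simpa [F] using this
    have hFsum : ∑ η, F η = 0 := by
      -- The sum does not depend on y, and its total over all y vanishes because g has mean zero.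
      have h1 : ∀ y, ∑ η : Equiv.Perm V, g (η⁻¹ y) = ∑ η, F η := fun y => by
        rw [← Equiv.sum_comp (Equiv.mulLeft (Equiv.swap y v))]
        simp [F]
      have h2 : ∑ y, ∑ η : Equiv.Perm V, g (η⁻¹ y) = 0 := by
        rw [Finset.sum_comm]
        refine Finset.sum_eq_zero fun η _ => ?_
        rw [← hgsum]
        exact Equiv.sum_comp η⁻¹ g
      simp_rw [h1] at h2
      simpa using h2
    have hFpos := sum_sq_pos_of_ne_zero hF0
    have h1 := hgapIP F hFsum
    have h2 := sum_mul_interchangeGenerator c F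
    have e : ∑ η, F η * interchangeGenerator c F η = -lam * ∑ η, F η ^ 2 := by
      rw [Finset.mul_sum]
      refine Finset.sum_congr rfl fun η _ => ?_
      rw [interchangeGenerator_lift, hgeig, Pi.smul_apply, smul_eq_mul]
      simp only [F]
      ring
    rw [e] at h2
    refine le_of_mul_le_mul_right ?_ hFpos
    linarith
  · have h1 := interchange_poincare _ V rfl c hc lam hlam hgapRW f hfsum
    have h2 := sum_mul_interchangeGenerator c f
    have e : ∑ η, f η * (-μ • f) η = -μ * ∑ η, f η ^ 2 := by
      rw [Finset.mul_sum]
      exact Finset.sum_congr rfl fun η _ => by rw [Pi.smul_apply, smul_eq_mul]; ring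
    rw [hfeig, e] at h2
    refine le_of_mul_le_mul_right ?_ (sum_sq_pos_of_ne_zero hf0)
    linarith
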